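/- **Corollary (decidability of tree (commutative) (cca-)piecewise testability).** *Trees, forests, contexts.* Let $\mathbb A$ be a finite alphabet. Forests over $\mathbb A$ are finite sequences $t_1+\cdots+t_n$ ($n\ge 0$; the empty forest is $0$) of finite unranked ordered trees with nodes labelled in $\mathbb A$; a tree is $a s$ with root label $a\in\mathbb A$ and $s$ the forest of its immediate subtrees. A context is a forest in which one leaf is replaced by a hole $\Box$; $pt$ denotes the result of substituting the forest $t$ for the hole of the context $p$. A forest (tree) language is a set of forests (trees). *Pieces.* A forest $s$ is a *piece* of $t$ if $s$ is obtained from $t$ by removing nodes, i.e. $(s,t)$ is in the reflexive transitive closure of $\{(pt',pat') : p \text{ a context}, a\in\mathbb A, t' \text{ a forest}\}$; it is a *cca-piece* (cca = closest common ancestor) if $(s,t)$ is in the reflexive transitive closure of the set of those pairs for which $t'$ is a tree or empty. A *reordering* of $t$ is a forest equivalent to $t$ under the least equivalence relation that identifies $p(s+t')$ with $p(t'+s)$ for all contexts $p$ and forests $s,t'$. A *commutative (cca-)piece* of $t$ is a (cca-)piece of some reordering of $t$. A forest language $K$ is *(commutative) (cca-)piecewise testable* if there is $n\ge 0$ such that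 membership of a forest $t$ in $K$ depends only on the set of (commutative) (cca-)pieces of $t$ that have at most $n$ nodes. A tree language $L$ is *tree (commutative) (cca-)piecewise testable* if $L$ is the set of all trees of some (commutative) (cca-)piecewise testable forest language. *Regular languages.* A forest algebra $(H,V)$ consists of a monoid $(H,+,0)$, not necessarily commutative, a monoid $(V,\cdot,\Box)$ and a faithful monoid action of $V$ on the left of $H$ such that for every $g\in H$ there are elements $g+\Box$ and $\Box+g$ of $V$ with $(g+\Box)h=g+h$ and $(\Box+g)h=h+g$ for all $h\in H$. A map $f:\mathbb A\to V$ determines the evaluation $\alpha$ of forests in $H$ with $\alpha(0)=0$, $\alpha(s+t)=\alpha(s)+\alpha(t)$ and $\alpha(as)=f(a)\,\alpha(s)$. A forest language is regular if it equals $\alpha^{-1}(X)$ for such an $\alpha$ into a finite forest algebra and some $X\subseteq H$. A regular language is presented by the operation tables of $(H,V)$, the map $f$ and the set $X$. *Statement.* It is decidable whether a regular tree language is tree piecewise testable; likewise for tree cca-piecewise testable, tree commutative-piecewise testable, and tree commutative-cca-piecewise testable. That is, for each of these four properties there is an algorithm that, given a presentation (for any finite alphabet) of a regular language $L$ consisting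 of trees only, decides whether $L$ has the property. -/

import Mathlib

universe u

namespace PiecewiseTestable

/-- Finite unranked ordered trees with node labels in `A`: a root label together with the
finite sequence of the immediate subtrees. The leaf `a` is `node a []`. -/
inductive UTree (A : Type u) : Type u
  | node : A → List (UTree A) → UTree A

/-- Forests are finite sequences of trees; `0` is `[]` and `s + t` is `s ++ t`. -/
abbrev Forest (A : Type u) : Type u := List (UTree A)

/-- The forest consists of exactly one tree. -/
def IsTree {A : Type u} (t : Forest A) : Prop := ∃ (a : A) (s : Forest A), t = [UTree.node a s]

mutual

/-- Number of nodes of a tree. -/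
def treeSize {A : Type u} : UTree A → ℕ
  | .node _ s => forestSize s + 1

/-- Number of nodes of a forest. -/
def forestSize {A : Type u} : List (UTree A) → ℕ
  | [] => 0
  | t :: s => treeSize t + forestSize s

end

/-- Contexts, i.e. forests in which one leaf is the hole `□`. -/
inductive Context (A : Type u) : Type u
  /-- The context `l + □ + r`. -/
  | hole (l r : Forest A) : Context A
  /-- The context `l + a p + r`. -/
  | node (l : Forest A) (a : A) (p : Context A) (r : Forest A) : Context A

/-- Substitution of a forest for the hole of a context. -/
def Context.fill {A : Type u} : Context A → Forest A → Forest A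
  | .hole l r, t => l ++ t ++ r
  | .node l a p r, t => l ++ [UTree.node a (p.fill t)] ++ r

/-- `Piece s t`: `s` is a piece of `t`, i.e. `s` arises from `t` by successively removing nodes
(the reflexive transitive closure of the pairs `(p t, p a t)`). -/
def Piece {A : Type u} : Forest A → Forest A → Prop :=
  Relation.ReflTransGen fun s s' =>
    ∃ (p : Context A) (a : A) (t : Forest A), s = p.fill t ∧ s' = p.fill [UTree.node a t]

/-- `CcaPiece s t`: `s` is a cca-piece of `t` (the reflexive transitive closure of the pairs
`(p t, p a t)` with `t` a tree or empty). -/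
def CcaPiece {A : Type u} : Forest A → Forest A → Prop :=
  Relation.ReflTransGen fun s s' =>
    ∃ (p : Context A) (a : A) (t : Forest A),
      (IsTree t ∨ t = []) ∧ s = p.fill t ∧ s' = p.fill [UTree.node a t]

/-- Reordering of siblings: the least equivalence relation that identifies `p (s + t)` with
`p (t + s)`. -/
def Reordering {A : Type u} : Forest A → Forest A → Prop :=
  Relation.EqvGen fun x y =>
    ∃ (p : Context A) (s t : Forest A), x = p.fill (s ++ t) ∧ y = p.fill (t ++ s)

/-- `s` is a piece of some reordering of `t`. -/
def CommPiece {A : Type u} (s t : Forest A) : Prop := ∃ t', Reordering t t' ∧ Piece s t'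

/-- `s` is a cca-piece of some reordering of `t`. -/
def CommCcaPiece {A : Type u} (s t : Forest A) : Prop := ∃ t', Reordering t t' ∧ CcaPiece s t'

/-- For a notion of piece `R` (`R s t` meaning that `s` is a piece of `t`): for some `n`,
membership of a forest in `K` is determined by the set of its pieces with at most `n` nodes. -/
def IsTestable {A : Type u} (R : Forest A → Forest A → Prop) (K : Set (Forest A)) : Prop :=
  ∃ n : ℕ, ∀ t t' : Forest A,
    (∀ s : Forest A, forestSize s ≤ n → (R s t ↔ R s t')) → (t ∈ K ↔ t' ∈ K)

/-- `L` is the set of all trees of some testable forest language. -/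
def IsTreeTestable {A : Type u} (R : Forest A → Forest A → Prop) (L : Set (Forest A)) : Prop :=
  ∃ K : Set (Forest A), IsTestable R K ∧ L = K ∩ {t | IsTree t}

/-- `L` is the set of trees of a piecewise testable forest language. -/
def IsTreePT {A : Type u} (L : Set (Forest A)) : Prop := IsTreeTestable Piece L

/-- `L` is the set of trees of a cca-piecewise testable forest language. -/
def IsTreeCcaPT {A : Type u} (L : Set (Forest A)) : Prop := IsTreeTestable CcaPiece L

/-- `L` is the set of trees of a commutative-piecewise testable forest language. -/
def IsTreeCommPT {A : Type u} (L : Set (Forest A)) : Prop := IsTreeTestable CommPiece L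

/-- `L` is the set of trees of a commutative-cca-piecewise testable forest language. -/
def IsTreeCommCcaPT {A : Type u} (L : Set (Forest A)) : Prop := IsTreeTestable CommCcaPiece L

/-- Forest algebras `(H, V)`: monoids `H` (additive, not necessarily commutative) and `V`
(multiplicative), with a faithful monoidal left action of `V` on `H`, such that `V` contains
`g + □` and `□ + g` for every `g` in `H`. -/
class ForestAlgebra (H V : Type*) [AddMonoid H] [Monoid V] [MulAction V H] : Prop
    extends FaithfulSMul V H where
  exists_add_left : ∀ g : H, ∃ v : V, ∀ h : H, v • h = g + h
  exists_add_right : ∀ g : H, ∃ v : V, ∀ h : H, v • h = h + g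

mutual

/-- Value of a tree under the morphism from the free forest algebra given by `f`;
see `evalForest`. -/
def evalTree {A H V : Type*} [AddMonoid H] [Monoid V] [MulAction V H] (f : A → V) : UTree A → H
  | .node a s => f a • evalForest f s

/-- Value of a forest under the unique morphism from the free forest algebra over `A` to `(H, V)`
that maps the context `a □` to `f a`, for each letter `a`. -/
def evalForest {A H V : Type*} [AddMonoid H] [Monoid V] [MulAction V H] (f : A → V) :
    List (UTree A) → H
  | [] => 0
  | t :: s => evalTree f t + evalForest f s

end

/-- The forest language recognized by the morphism given by `f` with the accepting set `X`. -/
def recognized {A H V : Type*} [AddMonoid H] [Monoid V] [MulAction V H] (f : A → V) (X : Set H) :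
    Set (Forest A) :=
  {t | evalForest f t ∈ X}

/-- Finite data that present a morphism into a finite forest algebra with an accepting set:
the table of `+` on `H`, the index of `0`, the table of the product on `V`, the index of `□`,
the table of the action, the images of the letters, and the characteristic vector of the
accepting set. The sizes of the alphabet, of `H` and of `V` are the lengths of these lists. -/
abbrev Presentation : Type :=
  List (List ℕ) × ℕ × List (List ℕ) × ℕ × List (List ℕ) × List ℕ × List Bool

open Classical in
/-- The presentation of the morphism given by `f` and the accepting set `X`, relative to
enumerations of the alphabet and of the algebra. -/
noncomputable def presentation {A H V : Type*} [AddMonoid H] [Monoid V] [MulAction V H]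
    {k m n : ℕ} (eA : Fin k ≃ A) (eH : Fin m ≃ H) (eV : Fin n ≃ V) (f : A → V) (X : Set H) :
    Presentation :=
  (List.ofFn fun i => List.ofFn fun j => (eH.symm (eH i + eH j) : ℕ),
   (eH.symm 0 : ℕ),
   List.ofFn fun i => List.ofFn fun j => (eV.symm (eV i * eV j) : ℕ),
   (eV.symm 1 : ℕ),
   List.ofFn fun i => List.ofFn fun j => (eH.symm (eV i • eH j) : ℕ),
   List.ofFn fun a => (eV.symm (f (eA a)) : ℕ),
   List.ofFn fun i => decide (eH i ∈ X))

/-- A property `P` of tree languages is decidable for regular tree languages: one algorithm,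
which works for all finite alphabets, decides `P L` for every set of trees `L`, from any
presentation of a finite forest algebra and a morphism that recognizes `L`. -/
def DecidableForRegularTreeLanguages (P : ∀ A : Type u, Set (Forest A) → Prop) : Prop :=
  ∃ test : Presentation → Bool, Computable test ∧
    ∀ (A H V : Type u) [AddMonoid H] [Monoid V] [MulAction V H] [ForestAlgebra H V]
      (k m n : ℕ) (eA : Fin k ≃ A) (eH : Fin m ≃ H) (eV : Fin n ≃ V) (f : A → V) (X : Set H),
      (∀ t ∈ recognized f X, IsTree t) →
        (test (presentation eA eH eV f X) = true ↔ P A (recognized f X))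

end PiecewiseTestable

namespace PiecewiseTestable

-- Both testability and its failure are witnessed by finite certificates that can be checked
-- mechanically, so both are recursively enumerable and testability is decidable by Post's theorem.
--
-- All four notions of piece are expressed by `PieceRel`: an ordered embedding `Emb false cca`
-- followed by a cca-embedding `Emb comm true`. A piece with `n` nodes factors through a cca-piece
-- with at most `2 * n` nodes (`Emb.exists_size_le`). Forests with the same cca-pieces of bounded
-- size and the same automaton value form finitely many types, compatible with the construction of
-- forests. Testability with a given `n` thus needs to be verified on one representative of each
-- type only (`testable_iff_exists_posCert`).
--
-- If testability fails, there are accepted trees and rejected trees that agree on ever larger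
-- pieces. By Kruskal's theorem both sequences may be taken increasing. The downward closure of each
-- is then an ideal; since the order is a well-quasi-order, the ideal consists of the forests whose
-- small pieces are pieces of a single tree, `t₀` or `t₁`. Conversely, two such sets that are
-- directed, by bounds of the types of `t₀` and `t₁`, and cofinal in each other refute testability
-- (`not_testable_iff`).
--
-- It remains to certify directedness and cofinality. The pairs of forests without a common upper
-- bound of a given type have minimal elements of bounded size, so the existence of such a bound
-- depends only on small pieces. Finitely many instances of this can be checked, and they suffice to
-- build upper bounds for all pairs by induction (`exists_dirCert`, `DirCert.exists_upper_bound`).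

/-- Forests with natural labels in first-child/next-sibling form: `node a c s` is the forest whose
first tree has the root label `a` and the forest `c` below the root, and whose other trees
form `s`. -/
inductive BForest : Type
  | nil : BForest
  | node : ℕ → BForest → BForest → BForest

-- Forests in first-child/next-sibling form and their embeddings.

namespace BForest

/-- Concatenation of forests. -/
def app : BForest → BForest → BForest
  | nil, y => y
  | node a c s, y => node a c (app s y)

/-- Number of nodes. -/
def size : BForest → ℕ
  | nil => 0
  | node _ c s => size c + size s + 1

/-- All labels are less than `k`. -/
def Val (k : ℕ) : BForest → Prop
  | nil => True
  | node a c s => a < k ∧ Val k c ∧ Val k s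

/-- At most one tree. -/
def Small : BForest → Prop
  | nil => True
  | node _ _ s => s = nil

/-- Exactly one tree. -/
def Single : BForest → Prop
  | nil => False
  | node _ _ s => s = nil

@[simp] theorem nil_app (y : BForest) : app nil y = y := rfl

@[simp] theorem node_app (a : ℕ) (c s y : BForest) : app (node a c s) y = node a c (app s y) := rfl

@[simp] theorem app_nil (x : BForest) : app x nil = x := by
  induction x with
  | nil => rfl
  | node a c s _ ih => simp [ih]

theorem app_assoc (x y z : BForest) : app (app x y) z = app x (app y z) := by
  induction x with
  | nil => rfl
  | node a c s _ ih => simp [ih]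

theorem size_app (x y : BForest) : size (app x y) = size x + size y := by
  induction x with
  | nil => simp [size]
  | node a c s _ ih => simp only [node_app, size, ih]; omega

theorem size_eq_zero {x : BForest} : size x = 0 ↔ x = nil := by
  cases x <;> simp [size]

theorem Single.small {x : BForest} (h : Single x) : Small x := by
  cases x <;> simp_all [Single, Small]

theorem small_iff {x : BForest} : Small x ↔ x = nil ∨ Single x := by
  cases x <;> simp [Single, Small]

/-- `Inter x y z`: the sequence of trees `z` is an interleaving of `x` and `y`. -/
inductive Inter : BForest → BForest → BForest → Prop
  | nil : Inter nil nil nil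
  | left (a : ℕ) (c : BForest) {x y z : BForest} :
      Inter x y z → Inter (node a c x) y (node a c z)
  | right (a : ℕ) (c : BForest) {x y z : BForest} :
      Inter x y z → Inter x (node a c y) (node a c z)

namespace Inter

theorem nil_left (x : BForest) : Inter BForest.nil x x := by
  induction x with
  | nil => exact .nil
  | node a c s _ ih => exact .right a c ih

theorem eq_of_nil_left {x y : BForest} (h : Inter BForest.nil x y) : y = x := by
  induction x generalizing y with
  | nil => cases h; rfl
  | node a c s _ ih => cases h with | right _ _ h => rw [ih h]

theorem symm {x y z : BForest} (h : Inter x y z) : Inter y x z := by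
  induction h with
  | nil => exact .nil
  | left a c _ ih => exact .right a c ih
  | right a c _ ih => exact .left a c ih

theorem app_eq (x y : BForest) : Inter x y (app x y) := by
  induction x with
  | nil => exact nil_left y
  | node a c s _ ih => exact .left a c ih

/-- Each tree of `z` comes from `u`, `x` or `y`; the forest `w` collects those from `u` or `x`. -/
theorem assoc_exists {u v x y z : BForest} (h : Inter u v z) (h' : Inter x y v) :
    ∃ w, Inter u x w ∧ Inter w y z := by
  induction h generalizing x y with
  | nil => cases h'; exact ⟨_, .nil, .nil⟩
  | left a c _ ih =>
    obtain ⟨w, h1, h2⟩ := ih h'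
    exact ⟨_, .left a c h1, .left a c h2⟩
  | right a c h ih =>
    cases h' with
    | left _ _ h' =>
      obtain ⟨w, h1, h2⟩ := ih h'
      exact ⟨_, .right a c h1, .left a c h2⟩
    | right _ _ h' =>
      obtain ⟨w, h1, h2⟩ := ih h'
      exact ⟨_, h1, .right a c h2⟩

end Inter

/-- Concatenation (`comm = false`) or interleaving (`comm = true`). -/
def Mix (comm : Bool) (x y z : BForest) : Prop :=
  if comm then Inter x y z else z = app x y

section Mix

variable {comm : Bool} {u v w x y z : BForest}

theorem Mix.of_app (comm : Bool) (x y : BForest) : Mix comm x y (app x y) := by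
  cases comm
  · rfl
  · exact Inter.app_eq x y

theorem Mix.inter (h : Mix comm x y z) : Inter x y z := by
  cases comm
  · cases h; exact Inter.app_eq x y
  · exact h

theorem Mix.nil_left (x : BForest) : Mix comm nil x x := Mix.of_app comm nil x

theorem Mix.nil_right (x : BForest) : Mix comm x nil x := by
  simpa using Mix.of_app comm x nil

theorem Mix.eq_of_nil_left (h : Mix comm nil x y) : y = x := h.inter.eq_of_nil_left

theorem Mix.eq_of_nil_right (h : Mix comm x nil y) : y = x := h.inter.symm.eq_of_nil_left

theorem Mix.assoc_exists (h : Mix comm u v z) (h' : Mix comm x y v) :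
    ∃ w, Mix comm u x w ∧ Mix comm w y z := by
  cases comm
  · cases h; cases h'; exact ⟨_, rfl, (app_assoc _ _ _).symm⟩
  · exact Inter.assoc_exists h h'

theorem Mix.assoc_exists' (h : Mix comm w y z) (h' : Mix comm u x w) :
    ∃ v, Mix comm x y v ∧ Mix comm u v z := by
  cases comm
  · cases h; cases h'; exact ⟨_, rfl, app_assoc _ _ _⟩
  · obtain ⟨v, h1, h2⟩ := Inter.assoc_exists (Inter.symm h) (Inter.symm h')
    exact ⟨v, h1.symm, h2.symm⟩

theorem Mix.size_eq (h : Mix comm x y z) : size z = size x + size y := by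
  have := h.inter
  clear h
  induction this with
  | nil => rfl
  | left a c _ ih => simp only [size, ih]; omega
  | right a c _ ih => simp only [size, ih]; omega

theorem Mix.val_iff {k : ℕ} (h : Mix comm x y z) : Val k z ↔ Val k x ∧ Val k y := by
  have := h.inter
  clear h
  induction this with
  | nil => simp [Val]
  | left a c _ ih => simp only [Val, ih]; tauto
  | right a c _ ih => simp only [Val, ih]; tauto

end Mix

/-- `Emb comm cca x t`: the forest `x` arises from `t` by removal of nodes, after a reordering of
siblings if `comm` is true; only nodes with at most one child are removed if `cca` is true. -/
def Emb (comm cca : Bool) : BForest → BForest → Prop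
  | x, nil => x = nil
  | x, node a c s => ∃ x₁ x₂, Mix comm x₁ x₂ x ∧ Emb comm cca x₂ s ∧
      (((cca = true → Small x₁) ∧ Emb comm cca x₁ c) ∨
        ∃ x', x₁ = node a x' nil ∧ Emb comm cca x' c)

section Emb

variable {comm cca : Bool} {x y z t x₁ x₂ t₁ t₂ : BForest} {a : ℕ}

theorem Emb.refl (x : BForest) : Emb comm cca x x := by
  induction x with
  | nil => rfl
  | node a c s ihc ihs =>
    exact ⟨node a c nil, s, Mix.of_app comm _ _, ihs, .inr ⟨c, rfl, ihc⟩⟩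

theorem Emb.nil_left (t : BForest) : Emb comm cca nil t := by
  induction t with
  | nil => rfl
  | node a c s ihc ihs => exact ⟨nil, nil, Mix.nil_left _, ihs, .inl ⟨fun _ => trivial, ihc⟩⟩

theorem Emb.eq_nil (h : Emb comm cca x nil) : x = nil := h

theorem Emb.val {k : ℕ} (h : Emb comm cca x t) (ht : Val k t) : Val k x := by
  induction t generalizing x with
  | nil => cases h; trivial
  | node a c s ihc ihs =>
    obtain ⟨x₁, x₂, hm, h2, h1⟩ := h
    obtain ⟨ha, hc, hs⟩ := ht
    refine hm.val_iff.2 ⟨?_, ihs h2 hs⟩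
    rcases h1 with ⟨_, h1⟩ | ⟨x', rfl, h1⟩
    · exact ihc h1 hc
    · exact ⟨ha, ihc h1 hc, trivial⟩

theorem Emb.mix_app (hm : Mix comm x₁ x₂ x) (h₁ : Emb comm cca x₁ t₁) (h₂ : Emb comm cca x₂ t₂) :
    Emb comm cca x (app t₁ t₂) := by
  induction t₁ generalizing x x₁ with
  | nil => cases h₁; rwa [hm.eq_of_nil_left]
  | node a c s _ ihs =>
    obtain ⟨y₁, y₂, hm', hy₂, hy₁⟩ := h₁
    obtain ⟨v, h1, h2⟩ := hm.assoc_exists' hm'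
    exact ⟨y₁, v, h2, ihs h1 hy₂, hy₁⟩

theorem Emb.app (h₁ : Emb comm cca x₁ t₁) (h₂ : Emb comm cca x₂ t₂) :
    Emb comm cca (app x₁ x₂) (BForest.app t₁ t₂) :=
  .mix_app (.of_app ..) h₁ h₂

theorem Emb.exists_of_app (h : Emb comm cca x (BForest.app t₁ t₂)) :
    ∃ x₁ x₂, Mix comm x₁ x₂ x ∧ Emb comm cca x₁ t₁ ∧ Emb comm cca x₂ t₂ := by
  induction t₁ generalizing x with
  | nil => exact ⟨nil, x, .nil_left _, rfl, h⟩
  | node a c s _ ihs =>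
    obtain ⟨y₁, y₂, hm, hy₂, hy₁⟩ := h
    obtain ⟨z₁, z₂, hm', h1, h2⟩ := ihs hy₂
    obtain ⟨w, hw1, hw2⟩ := hm.assoc_exists hm'
    exact ⟨w, z₂, hw2, ⟨y₁, z₁, hw1, h1, hy₁⟩, h2⟩

/-- Each tree of `t` has its own remainder in `x`. Grouping the remainders according to the origin
of the trees, `t₁` or `t₂`, only takes rebracketing. -/
theorem Emb.exists_of_mix (h : Emb comm cca x t) (hm : Mix comm t₁ t₂ t) :
    ∃ x₁ x₂, Mix comm x₁ x₂ x ∧ Emb comm cca x₁ t₁ ∧ Emb comm cca x₂ t₂ := by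
  cases comm
  · cases hm; exact h.exists_of_app
  · replace hm : Inter t₁ t₂ t := hm
    induction hm generalizing x with
    | nil => cases h; exact ⟨nil, nil, .nil, rfl, rfl⟩
    | left a c _ ih =>
      obtain ⟨y₁, y₂, hm, hy₂, hy₁⟩ := h
      obtain ⟨z₁, z₂, hm', h1, h2⟩ := ih hy₂
      obtain ⟨w, hw1, hw2⟩ := hm.assoc_exists hm'
      exact ⟨w, z₂, hw2, ⟨y₁, z₁, hw1, h1, hy₁⟩, h2⟩
    | right a c _ ih =>
      obtain ⟨y₁, y₂, hm, hy₂, hy₁⟩ := h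
      obtain ⟨z₁, z₂, hm', h1, h2⟩ := ih hy₂
      obtain ⟨w, hw1, hw2⟩ := hm.assoc_exists (Inter.symm hm')
      exact ⟨z₁, w, hw2.symm, h1, ⟨y₁, z₂, hw1, h2, hy₁⟩⟩

theorem Emb.node_nil_iff : Emb comm cca x (node a t nil) ↔
    ((cca = true → Small x) ∧ Emb comm cca x t) ∨ ∃ x', x = node a x' nil ∧ Emb comm cca x' t := by
  constructor
  · rintro ⟨x₁, x₂, hm, rfl, h⟩
    rwa [hm.eq_of_nil_right]
  · exact fun h => ⟨x, nil, .nil_right x, rfl, h⟩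

/-- Needed for transitivity with `cca`: what is left below a removed root stays small under further
removals. -/
theorem Emb.small (h : Emb comm true x t) (ht : Small t) : Small x := by
  cases t with
  | nil => cases h; trivial
  | node a c s =>
    cases ht
    rcases Emb.node_nil_iff.1 h with h | ⟨x', rfl, _⟩
    · exact h.1 rfl
    · rfl

theorem Emb.trans (h₁ : Emb comm cca x y) (h₂ : Emb comm cca y t) : Emb comm cca x t := by
  induction t generalizing x y with
  | nil => cases h₂; exact h₁
  | node a c s ihc ihs =>
    obtain ⟨y₁, y₂, hm, hy₂, hy₁⟩ := h₂
    obtain ⟨x₁, x₂, hm', hx₁, hx₂⟩ := h₁.exists_of_mix hm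
    refine ⟨x₁, x₂, hm', ihs hx₂ hy₂, ?_⟩
    rcases hy₁ with ⟨hs, hy₁⟩ | ⟨y', rfl, hy'⟩
    · refine .inl ⟨fun h => ?_, ihc hx₁ hy₁⟩
      subst h
      exact hx₁.small (hs rfl)
    · rcases Emb.node_nil_iff.1 hx₁ with h | ⟨x', rfl, hx'⟩
      · exact .inl ⟨h.1, ihc h.2 hy'⟩
      · exact .inr ⟨x', rfl, ihc hx' hy'⟩

theorem Emb.mono {comm' cca' : Bool} (hcomm : comm = true → comm' = true)
    (hcca : cca' = true → cca = true) (h : Emb comm cca x t) : Emb comm' cca' x t := by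
  induction t generalizing x with
  | nil => exact h
  | node a c s ihc ihs =>
    obtain ⟨x₁, x₂, hm, h2, h1⟩ := h
    refine ⟨x₁, x₂, ?_, ihs h2, ?_⟩
    · cases comm'
      · cases comm
        · exact hm
        · exact absurd (hcomm rfl) (by simp)
      · exact hm.inter
    · rcases h1 with ⟨hs, h1⟩ | ⟨x', rfl, h1⟩
      · exact .inl ⟨fun h => hs (hcca h), ihc h1⟩
      · exact .inr ⟨x', rfl, ihc h1⟩

/-- `Emb false true` is the finest of the four relations, so it is enough to prove that this one is
a well-quasi-order. -/
theorem Emb.of_cca (h : Emb false true x t) : Emb comm cca x t :=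
  h.mono (by simp) (by simp)

theorem Emb.node (a : ℕ) (h₁ : Emb comm cca x₁ t₁) (h₂ : Emb comm cca x₂ t₂) :
    Emb comm cca (node a x₁ x₂) (BForest.node a t₁ t₂) :=
  ⟨BForest.node a x₁ nil, x₂, .of_app .., h₂, .inr ⟨x₁, rfl, h₁⟩⟩

end Emb

end BForest
-- Kruskal's tree theorem and bounds for minimal elements.
namespace BForest

instance (comm cca : Bool) : IsPreorder BForest (Emb comm cca) where
  refl := Emb.refl
  trans _ _ _ := Emb.trans

/-- The trees of a forest, as one-tree forests. -/
def trees : BForest → List BForest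
  | nil => []
  | node a c s => node a c nil :: trees s

/-- Reduction to Higman's order on sequences of trees: an unmatched tree of `y` is deleted entirely,
which is possible leaf by leaf and hence also with `cca`. -/
theorem emb_of_sublistForall₂ {comm cca : Bool} {x y : BForest}
    (h : List.SublistForall₂ (Emb comm cca) (trees x) (trees y)) : Emb comm cca x y := by
  generalize hl : trees x = l at h
  generalize hr : trees y = r at h
  induction h generalizing x y with
  | nil =>
    cases x with
    | nil => exact Emb.nil_left y
    | node => simp [trees] at hl
  | cons h _ ih =>
    cases x with
    | nil => simp [trees] at hl
    | node a c s =>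
      cases y with
      | nil => simp [trees] at hr
      | node b d s' =>
        simp only [trees, List.cons.injEq] at hl hr
        obtain ⟨rfl, hl⟩ := hl
        obtain ⟨rfl, hr⟩ := hr
        exact Emb.app (x₁ := node a c nil) (t₁ := node b d nil) h (ih hl hr)
  | cons_right _ ih =>
    cases y with
    | nil => simp [trees] at hr
    | node b d s' =>
      simp only [trees, List.cons.injEq] at hr
      exact ⟨nil, x, .nil_left x, ih hl hr.2, .inl ⟨fun _ => trivial, .nil_left d⟩⟩

theorem mem_trees {k : ℕ} {x T : BForest} (hx : Val k x) (h : T ∈ trees x) :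
    Val k T ∧ Single T ∧ size T ≤ size x ∧ Emb false true T x := by
  induction x with
  | nil => simp [trees] at h
  | node a c s _ ih =>
    obtain ⟨ha, hc, hs⟩ := hx
    rcases List.mem_cons.1 h with rfl | h
    · exact ⟨⟨ha, hc, trivial⟩, rfl, by simp [size], Emb.node a (.refl c) (.nil_left s)⟩
    · obtain ⟨h1, h2, h3, h4⟩ := ih hs h
      exact ⟨h1, h2, by simp only [size]; omega,
        nil, T, .nil_left T, h4, .inl ⟨fun _ => trivial, .nil_left c⟩⟩

/-- **Kruskal's tree theorem** for trees with labels less than `k`. -/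
theorem partiallyWellOrderedOn_single (k : ℕ) :
    {x | Val k x ∧ Single x}.PartiallyWellOrderedOn (Emb false true) := by
  -- Nash-Williams' argument: in a bad sequence that is minimal for `size`, the subtrees just below
  -- the roots are well-quasi-ordered, so Higman's lemma applies to the sequences of children.
  rw [Set.PartiallyWellOrderedOn.iff_not_exists_isMinBadSeq size]
  rintro ⟨f, ⟨hf, hbad⟩, hmin⟩
  choose a ha c hfc hc using fun n => show ∃ a, a < k ∧ ∃ c, f n = node a c nil ∧ Val k c by
    obtain ⟨h1, h2⟩ := hf n
    cases h : f n with
    | nil => rw [h] at h2; exact h2.elim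
    | node a c s =>
      rw [h] at h1 h2
      cases h2
      exact ⟨a, h1.1, c, rfl, h1.2.1⟩
  have hsub : {T | ∃ n, T ∈ trees (c n)}.PartiallyWellOrderedOn (Emb false true) := by
    rw [Set.partiallyWellOrderedOn_iff_exists_lt]
    intro g hg
    by_contra! hgbad
    choose i hi using hg
    obtain ⟨m, hm⟩ : ∃ m, ∀ n, i m ≤ i n := by
      obtain ⟨_, ⟨m, rfl⟩, hm⟩ := WellFounded.has_min (wellFounded_lt (α := ℕ))
        (Set.range i) ⟨_, Set.mem_range_self 0⟩
      exact ⟨m, fun n => not_lt.1 (hm _ ⟨n, rfl⟩)⟩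
    have hT : ∀ n, Val k (g n) ∧ Single (g n) ∧ size (g n) < size (f (i n)) ∧
        Emb false true (g n) (f (i n)) := fun n => by
      obtain ⟨h1, h2, h3, h4⟩ := mem_trees (hc (i n)) (hi n)
      rw [hfc]
      exact ⟨h1, h2, by simp only [size]; omega,
        Emb.node_nil_iff.2 (.inl ⟨fun _ => h2.small, h4⟩)⟩
    -- `i m` is the least index of a member of `f` from which some `g n` is taken. Following `f`
    -- before `i m` and `g` from `m` on gives a bad sequence that is smaller at `i m`.
    refine hmin (i m) (fun n => if n < i m then f n else g (m + (n - i m)))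
      (fun n hn => (if_pos hn).symm) ?_ ⟨fun n => ?_, fun p q hpq => ?_⟩
    · simpa using (hT m).2.2.1
    · dsimp only
      split_ifs
      · exact hf n
      · exact ⟨(hT _).1, (hT _).2.1⟩
    · dsimp only
      split_ifs with hp hq hq
      · exact hbad p q hpq
      · intro h
        exact hbad p (i (m + (q - i m))) (hp.trans_le (hm _)) (h.trans (hT _).2.2.2)
      · omega
      · exact hgbad _ _ (by omega)
  have hlist := Set.PartiallyWellOrderedOn.partiallyWellOrderedOn_sublistForall₂ _ hsub
  obtain ⟨i, j, hij, h1, h2⟩ := ((Set.finite_Iio k).partiallyWellOrderedOn (r := (· = ·))).prod hlist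
    |>.exists_lt (f := fun n => (a n, trees (c n))) fun n => ⟨ha n, fun T hT => ⟨n, hT⟩⟩
  refine hbad i j hij ?_
  rw [hfc i, hfc j]
  dsimp only at h1 h2
  rw [h1]
  exact Emb.node _ (emb_of_sublistForall₂ h2) (.refl nil)

theorem partiallyWellOrderedOn_val (k : ℕ) :
    {x | Val k x}.PartiallyWellOrderedOn (Emb false true) := by
  rw [Set.partiallyWellOrderedOn_iff_exists_lt]
  intro f hf
  obtain ⟨i, j, hij, h⟩ := (Set.PartiallyWellOrderedOn.partiallyWellOrderedOn_sublistForall₂ _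
    (partiallyWellOrderedOn_single k)).exists_lt (f := fun n => trees (f n)) fun n T hT =>
      ⟨(mem_trees (hf n) hT).1, (mem_trees (hf n) hT).2.1⟩
  exact ⟨i, j, hij, emb_of_sublistForall₂ h⟩

/-- Every sequence of forests has an increasing subsequence. -/
theorem exists_emb_subseq {k : ℕ} (f : ℕ → BForest) (hf : ∀ n, Val k (f n)) :
    ∃ g : ℕ ↪o ℕ, ∀ m n : ℕ, m ≤ n → Emb false true (f (g m)) (f (g n)) :=
  (partiallyWellOrderedOn_val k).exists_monotone_subseq hf

/-- The minimal elements of an upward closed set of pairs have bounded size. -/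
theorem exists_size_bound_pair {k : ℕ} (U : Set (BForest × BForest))
    (hU : ∀ p ∈ U, Val k p.1 ∧ Val k p.2) :
    ∃ m, ∀ p ∈ U, ∃ q ∈ U, size q.1 ≤ m ∧ size q.2 ≤ m ∧
      Emb false true q.1 p.1 ∧ Emb false true q.2 p.2 := by
  by_contra! h
  choose f hf hbad using h
  obtain ⟨g, hg⟩ := exists_emb_subseq (fun n => (f n).1) fun n => (hU _ (hf n)).1
  obtain ⟨g', hg'⟩ := exists_emb_subseq (fun n => (f (g n)).2) fun n => (hU _ (hf _)).2
  -- No pair in `U` with components of size at most `j` lies below `f j`; but `j` is so far out that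
  -- `f i` is such a pair.
  set i := g (g' 0) with hi
  set j := g (g' (size (f i).1 + size (f i).2)) with hj
  have hle : size (f i).1 + size (f i).2 ≤ j :=
    (g'.strictMono.le_apply).trans (g.strictMono.le_apply)
  exact hbad j (f i) (hf i) (by omega) (by omega)
    (hg _ _ (g'.monotone (Nat.zero_le _))) (hg' _ _ (Nat.zero_le _))

/-- The minimal elements of a set of forests have bounded size. -/
theorem exists_size_bound {k : ℕ} (U : Set BForest) (hU : ∀ x ∈ U, Val k x) :
    ∃ m, ∀ x ∈ U, ∃ y ∈ U, size y ≤ m ∧ Emb false true y x := by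
  obtain ⟨m, hm⟩ := exists_size_bound_pair (k := k) {p | p.1 ∈ U ∧ p.2 = nil} fun p hp =>
    ⟨hU _ hp.1, by rw [hp.2]; trivial⟩
  refine ⟨m, fun x hx => ?_⟩
  obtain ⟨q, hq, h1, _, h2, _⟩ := hm (x, nil) ⟨hx, rfl⟩
  exact ⟨q.1, hq.1, h1, h2⟩

end BForest

-- The four notions of pieces in terms of embeddings.

section Transfer

variable {A : Type u}

open BForest

/-- Induction along the first tree and the remaining trees of a forest. -/
theorem forest_induction {P : Forest A → Prop} (nil : P [])
    (cons : ∀ a c s, P c → P s → P (UTree.node a c :: s)) : ∀ t, P t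
  | [] => nil
  | .node a c :: s => cons a c s (forest_induction nil cons c) (forest_induction nil cons s)

/-- The first-child/next-sibling form of a forest, with labels renamed by `e`. -/
def toB (e : A → ℕ) : List (UTree A) → BForest
  | [] => .nil
  | .node a c :: s => .node (e a) (toB e c) (toB e s)

variable {e : A → ℕ} {cca comm : Bool}

@[simp] theorem toB_nil : toB e [] = .nil := by simp [toB]

@[simp] theorem toB_cons (a : A) (c s : Forest A) :
    toB e (UTree.node a c :: s) = .node (e a) (toB e c) (toB e s) := by simp [toB]

@[simp] theorem toB_append (s t : Forest A) : toB e (s ++ t) = app (toB e s) (toB e t) := by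
  induction s with
  | nil => simp
  | cons T s ih => cases T; simp [ih]

theorem toB_eq_nil {t : Forest A} : toB e t = .nil ↔ t = [] := by
  rcases t with _ | ⟨⟨a, c⟩, s⟩ <;> simp

theorem exists_toB_eq {k : ℕ} (he : ∀ n < k, ∃ a, e a = n) {x : BForest} (hx : Val k x) :
    ∃ t, toB e t = x := by
  induction x with
  | nil => exact ⟨[], by simp⟩
  | node n c s ihc ihs =>
    obtain ⟨a, rfl⟩ := he n hx.1
    obtain ⟨c, rfl⟩ := ihc hx.2.1
    obtain ⟨s, rfl⟩ := ihs hx.2.2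
    exact ⟨UTree.node a c :: s, by simp⟩

theorem val_toB {k : ℕ} (he : ∀ a, e a < k) (t : Forest A) : Val k (toB e t) := by
  induction t using forest_induction with
  | nil => simp [Val]
  | cons a c s ihc ihs => simpa [Val] using ⟨he a, ihc, ihs⟩

theorem forestSize_eq (t : Forest A) : forestSize t = size (toB e t) := by
  induction t using forest_induction with
  | nil => simp [forestSize, size]
  | cons a c s ihc ihs => simp [forestSize, treeSize, size, ihc, ihs]; omega

theorem isTree_iff (t : Forest A) : IsTree t ↔ Single (toB e t) := by
  rcases t with _ | ⟨⟨a, c⟩, s⟩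
  · simp [IsTree, Single]
  · simp [IsTree, Single, toB_eq_nil]

theorem isTree_or_nil_iff (t : Forest A) : IsTree t ∨ t = [] ↔ Small (toB e t) := by
  rw [BForest.small_iff, isTree_iff (e := e), toB_eq_nil, or_comm]

theorem exists_append_of_toB_eq_app {t : Forest A} {x y : BForest} (h : toB e t = app x y) :
    ∃ t₁ t₂, t = t₁ ++ t₂ ∧ toB e t₁ = x ∧ toB e t₂ = y := by
  induction x generalizing t with
  | nil => exact ⟨[], t, rfl, by simp, h⟩
  | node a c s _ ih =>
    rcases t with _ | ⟨⟨b, d⟩, t⟩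
    · simp at h
    · simp only [toB_cons, node_app, BForest.node.injEq] at h
      obtain ⟨t₁, t₂, rfl, h1, h2⟩ := ih h.2.2
      exact ⟨UTree.node b d :: t₁, t₂, rfl, by simp [h.1, h.2.1, h1], h2⟩

/-- Contexts can be extended by siblings of the outermost level. -/
theorem Context.exists_fill_append (l r : Forest A) (p : Context A) :
    ∃ q : Context A, ∀ t, q.fill t = l ++ p.fill t ++ r := by
  cases p with
  | hole l' r' => exact ⟨.hole (l ++ l') (r' ++ r), fun t => by simp [Context.fill]⟩
  | node l' a p r' => exact ⟨.node (l ++ l') a p (r' ++ r), fun t => by simp [Context.fill]⟩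

theorem emb_fill (p : Context A) {s t : Forest A} (h : Emb comm cca (toB e s) (toB e t)) :
    Emb comm cca (toB e (p.fill s)) (toB e (p.fill t)) := by
  induction p with
  | hole l r =>
    simp only [Context.fill, toB_append]
    exact ((Emb.refl _).app h).app (.refl _)
  | node l a p r ih =>
    simp only [Context.fill, toB_append, toB_cons, toB_nil]
    exact ((Emb.refl _).app (.node _ ih (.refl _))).app (.refl _)

/-- One removal of a node, with at most one child if `cca` is true. -/
def Removal (cca : Bool) (s s' : Forest A) : Prop :=
  ∃ (p : Context A) (a : A) (t : Forest A),
    (cca = true → IsTree t ∨ t = []) ∧ s = p.fill t ∧ s' = p.fill [UTree.node a t]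

theorem piece_eq : Piece (A := A) = Relation.ReflTransGen (Removal false) := by
  unfold Piece Removal
  simp

theorem ccaPiece_eq : CcaPiece (A := A) = Relation.ReflTransGen (Removal true) := by
  unfold CcaPiece Removal
  simp

theorem Removal.append {s s' : Forest A} (l r : Forest A) (h : Removal cca s s') :
    Removal cca (l ++ s ++ r) (l ++ s' ++ r) := by
  obtain ⟨p, a, t, ht, rfl, rfl⟩ := h
  obtain ⟨q, hq⟩ := p.exists_fill_append l r
  exact ⟨q, a, t, ht, (hq _).symm, (hq _).symm⟩

theorem Removal.node {s s' : Forest A} (a : A) (h : Removal cca s s') :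
    Removal cca [UTree.node a s] [UTree.node a s'] := by
  obtain ⟨p, b, t, ht, rfl, rfl⟩ := h
  exact ⟨.node [] a p [], b, t, ht, rfl, rfl⟩

theorem reflTransGen_removal_append {s s' t t' : Forest A}
    (h : Relation.ReflTransGen (Removal cca) s s') (h' : Relation.ReflTransGen (Removal cca) t t') :
    Relation.ReflTransGen (Removal cca) (s ++ t) (s' ++ t') :=
  (h.lift (· ++ t) fun _ _ h => by simpa using h.append [] t).trans
    (h'.lift (s' ++ ·) fun _ _ h => by simpa using h.append s' [])

theorem emb_iff_reflTransGen (he : Function.Injective e) {s t : Forest A} :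
    Emb false cca (toB e s) (toB e t) ↔ Relation.ReflTransGen (Removal cca) s t := by
  constructor
  · intro h
    induction t using forest_induction generalizing s with
    | nil =>
      rw [toB_nil] at h
      rw [toB_eq_nil.1 h.eq_nil]
    | cons a c r ihc ihr =>
      rw [toB_cons] at h
      obtain ⟨x₁, x₂, hm, h2, h1⟩ := h
      obtain ⟨s₁, s₂, rfl, rfl, rfl⟩ := exists_append_of_toB_eq_app hm
      refine reflTransGen_removal_append (t' := r) (s' := [UTree.node a c]) ?_ (ihr h2)
      rcases h1 with ⟨hs, h1⟩ | ⟨x', hx', h1⟩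
      -- The nodes below `a` are removed before `a` itself, so that `a` has only `s₁` below it when
      -- its turn comes, as the condition for `cca` requires.
      · refine .head ⟨.hole [] [], a, s₁, fun h => (isTree_or_nil_iff _).2 (hs h), ?_, rfl⟩
          ((ihc h1).lift _ fun _ _ h => h.node a)
        simp [Context.fill]
      · rcases s₁ with _ | ⟨⟨b, d⟩, s₁⟩
        · simp at hx'
        · simp only [toB_cons, BForest.node.injEq] at hx'
          obtain ⟨hb, rfl, hx'⟩ := hx'
          rw [he hb, toB_eq_nil.1 hx']
          exact (ihc h1).lift _ fun _ _ h => h.node a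
  · intro h
    induction h with
    | refl => exact .refl _
    | tail _ h ih =>
      obtain ⟨p, a, t, ht, rfl, rfl⟩ := h
      refine ih.trans (emb_fill p ?_)
      simp only [toB_cons, toB_nil]
      exact Emb.node_nil_iff.2 (.inl ⟨fun h => (isTree_or_nil_iff _).1 (ht h), .refl _⟩)

theorem Reordering.refl (t : Forest A) : Reordering t t := Relation.EqvGen.refl t

theorem Reordering.symm {s t : Forest A} (h : Reordering s t) : Reordering t s :=
  Relation.EqvGen.symm _ _ h

theorem Reordering.trans {r s t : Forest A} (h : Reordering r s) (h' : Reordering s t) :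
    Reordering r t :=
  Relation.EqvGen.trans _ _ _ h h'

theorem Reordering.append_comm (s t : Forest A) : Reordering (s ++ t) (t ++ s) :=
  .rel _ _ ⟨.hole [] [], s, t, by simp [Context.fill], by simp [Context.fill]⟩

theorem Reordering.map {s t : Forest A} (f : Forest A → Forest A)
    (hf : ∀ p : Context A, ∃ q : Context A, ∀ t, q.fill t = f (p.fill t))
    (h : Reordering s t) : Reordering (f s) (f t) := by
  induction h with
  | rel _ _ h =>
    obtain ⟨p, s, t, rfl, rfl⟩ := h
    obtain ⟨q, hq⟩ := hf p
    exact .rel _ _ ⟨q, s, t, (hq _).symm, (hq _).symm⟩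
  | refl => exact .refl _
  | symm _ _ _ ih => exact ih.symm
  | trans _ _ _ _ _ ih ih' => exact ih.trans ih'

theorem Reordering.append {s s' t t' : Forest A} (h : Reordering s s') (h' : Reordering t t') :
    Reordering (s ++ t) (s' ++ t') :=
  (h.map (· ++ t) fun p => by simpa using p.exists_fill_append [] t).trans
    (h'.map (s' ++ ·) fun p => by simpa using p.exists_fill_append s' [])

theorem Reordering.node {s t : Forest A} (a : A) (h : Reordering s t) :
    Reordering [UTree.node a s] [UTree.node a t] :=
  h.map (fun s => [UTree.node a s]) fun p => ⟨.node [] a p [], fun _ => rfl⟩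

theorem emb_app_comm (x y : BForest) : Emb true cca (app x y) (app y x) :=
  .mix_app (Inter.app_eq x y).symm (.refl y) (.refl x)

theorem emb_of_reordering {s t : Forest A} (h : Reordering s t) :
    Emb true cca (toB e s) (toB e t) ∧ Emb true cca (toB e t) (toB e s) := by
  induction h with
  | rel _ _ h =>
    obtain ⟨p, s, t, rfl, rfl⟩ := h
    constructor <;> refine emb_fill p ?_ <;> rw [toB_append, toB_append] <;> exact emb_app_comm _ _
  | refl => exact ⟨.refl _, .refl _⟩
  | symm _ _ _ ih => exact ih.symm
  | trans _ _ _ _ _ ih ih' => exact ⟨ih.1.trans ih'.1, ih'.2.trans ih.2⟩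

/-- To interleave at most one tree with a sequence is to insert it at one place. -/
theorem exists_app_of_inter {x y z : BForest} (h : Inter x y z) (hx : Small x) :
    ∃ l r, y = app l r ∧ z = app l (app x r) := by
  induction h with
  | nil => exact ⟨.nil, .nil, rfl, rfl⟩
  | left a c h =>
    cases hx
    exact ⟨.nil, _, rfl, by rw [h.eq_of_nil_left]; rfl⟩
  | right a c _ ih =>
    obtain ⟨l, r, rfl, rfl⟩ := ih hx
    exact ⟨.node a c l, r, rfl, rfl⟩

/-- With `cca`, each tree of `t` leaves at most one tree behind, so no remainder straddles the cut
between `l` and `r`. -/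
theorem exists_append_of_emb_app {l r : BForest} {t : Forest A}
    (h : Emb false true (app l r) (toB e t)) :
    ∃ t₁ t₂, t = t₁ ++ t₂ ∧ Emb false true l (toB e t₁) ∧ Emb false true r (toB e t₂) := by
  induction t generalizing l with
  | nil =>
    rw [toB_nil] at h
    have h := h.eq_nil
    cases l with
    | nil => exact ⟨[], [], rfl, .nil_left _, by cases h; exact .nil_left _⟩
    | node => simp at h
  | cons T t ih =>
    rcases T with ⟨a, c⟩
    cases l with
    | nil => exact ⟨[], _, rfl, .nil_left _, h⟩
    | node b d l =>
      rw [toB_cons] at h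
      obtain ⟨x₁, x₂, hm, h2, h1⟩ := h
      have hsm : Small x₁ := by
        rcases h1 with h1 | ⟨x', rfl, _⟩
        · exact h1.1 rfl
        · rfl
      cases x₁ with
      | nil =>
        have hm : app (.node b d l) r = x₂ := hm
        obtain ⟨t₁, t₂, rfl, h3, h4⟩ := ih (hm ▸ h2)
        refine ⟨UTree.node a c :: t₁, t₂, rfl, ?_, h4⟩
        rw [toB_cons]
        exact ⟨.nil, _, rfl, h3, .inl ⟨fun _ => trivial, .nil_left _⟩⟩
      | node b' d' s =>
        cases hsm
        have hm : BForest.node b d (app l r) = .node b' d' x₂ := hm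
        simp only [BForest.node.injEq] at hm
        obtain ⟨rfl, rfl, rfl⟩ := hm
        obtain ⟨t₁, t₂, rfl, h3, h4⟩ := ih h2
        refine ⟨UTree.node a c :: t₁, t₂, rfl, ?_, h4⟩
        rw [toB_cons]
        exact ⟨.node b d .nil, l, rfl, h3, h1⟩

/-- The first tree of `t` is moved to the place where its remainder is inserted. This breaks down
for `Emb true false`: it would embed `b + d + c` into `a (b + c) + d`, although no reordering of the
latter has this piece. Hence the two-step form of `PieceRel`. -/
theorem exists_reordering_of_emb {x : BForest} {t : Forest A} (h : Emb true true x (toB e t)) :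
    ∃ t', Reordering t t' ∧ Emb false true x (toB e t') := by
  induction t using forest_induction generalizing x with
  | nil => exact ⟨[], .refl _, by rw [toB_nil] at h ⊢; exact h⟩
  | cons a c s ihc ihs =>
    rw [toB_cons] at h
    obtain ⟨x₁, x₂, hm, h2, h1⟩ := h
    obtain ⟨s', hs, hs'⟩ := ihs h2
    have hsm : Small x₁ := by
      rcases h1 with h1 | ⟨x', rfl, _⟩
      · exact h1.1 rfl
      · rfl
    obtain ⟨c', hc, hc'⟩ : ∃ c', Reordering c c' ∧
        Emb false true x₁ (toB e [UTree.node a c']) := by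
      rw [← exists_congr fun c' => by rw [toB_cons, toB_nil, Emb.node_nil_iff]]
      rcases h1 with ⟨_, h1⟩ | ⟨x', rfl, h1⟩
      · obtain ⟨c', hc, hc'⟩ := ihc h1
        exact ⟨c', hc, .inl ⟨fun _ => hsm, hc'⟩⟩
      · obtain ⟨c', hc, hc'⟩ := ihc h1
        exact ⟨c', hc, .inr ⟨x', rfl, hc'⟩⟩
    obtain ⟨l, r, rfl, rfl⟩ := exists_app_of_inter hm hsm
    obtain ⟨t₁, t₂, rfl, hl, hr⟩ := exists_append_of_emb_app hs'
    refine ⟨t₁ ++ ([UTree.node a c'] ++ t₂), ?_, ?_⟩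
    · have h1 : Reordering ([UTree.node a c] ++ s) ([UTree.node a c'] ++ (t₁ ++ t₂)) :=
        (hc.node a).append hs
      have h2 : Reordering ([UTree.node a c'] ++ t₁ ++ t₂) (t₁ ++ [UTree.node a c'] ++ t₂) :=
        (Reordering.append_comm _ _).append (.refl _)
      simp only [List.append_assoc] at h2
      exact h1.trans h2
    · rw [toB_append, toB_append]
      exact hl.app (hc'.app hr)

/-- The four notions of pieces, on forests in first-child/next-sibling form. -/
def PieceRel (comm cca : Bool) (x t : BForest) : Prop :=
  ∃ u, Emb false cca x u ∧ Emb comm true u t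

theorem pieceRel_false_iff {x t : BForest} : PieceRel false cca x t ↔ Emb false cca x t :=
  ⟨fun ⟨_, h, h'⟩ => h.trans h'.of_cca, fun h => ⟨t, h, .refl t⟩⟩

theorem piece_iff (he : Function.Injective e) {s t : Forest A} :
    Piece s t ↔ PieceRel false false (toB e s) (toB e t) := by
  rw [piece_eq, pieceRel_false_iff, emb_iff_reflTransGen he]

theorem ccaPiece_iff (he : Function.Injective e) {s t : Forest A} :
    CcaPiece s t ↔ PieceRel false true (toB e s) (toB e t) := by
  rw [ccaPiece_eq, pieceRel_false_iff, emb_iff_reflTransGen he]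

theorem pieceRel_true_iff (he : Function.Injective e) {s t : Forest A} :
    PieceRel true cca (toB e s) (toB e t) ↔
      ∃ t', Reordering t t' ∧ Relation.ReflTransGen (Removal cca) s t' := by
  constructor
  · rintro ⟨u, h1, h2⟩
    obtain ⟨t', ht', h3⟩ := exists_reordering_of_emb h2
    exact ⟨t', ht', (emb_iff_reflTransGen he).1 (h1.trans h3.of_cca)⟩
  · rintro ⟨t', ht', h⟩
    exact ⟨toB e t', (emb_iff_reflTransGen he).2 h, (emb_of_reordering ht').2⟩

theorem commPiece_iff (he : Function.Injective e) {s t : Forest A} :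
    CommPiece s t ↔ PieceRel true false (toB e s) (toB e t) := by
  rw [pieceRel_true_iff he, ← piece_eq]
  rfl

theorem commCcaPiece_iff (he : Function.Injective e) {s t : Forest A} :
    CommCcaPiece s t ↔ PieceRel true true (toB e s) (toB e t) := by
  rw [pieceRel_true_iff he, ← ccaPiece_eq]
  rfl

/-- Testability of the set of all trees with labels less than `k` that satisfy `P`. -/
def Testable (k : ℕ) (comm cca : Bool) (P : BForest → Prop) : Prop :=
  ∃ n, ∀ t t', Val k t → Val k t' → Single t → Single t' →
    (∀ s, Val k s → size s ≤ n → (PieceRel comm cca s t ↔ PieceRel comm cca s t')) → (P t ↔ P t')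

theorem isTreeTestable_iff {k : ℕ} (hk : ∀ n, n < k ↔ ∃ a, e a = n)
    {R : Forest A → Forest A → Prop} (hR : ∀ s t, R s t ↔ PieceRel comm cca (toB e s) (toB e t))
    {L : Set (Forest A)} {P : BForest → Prop} (hL : ∀ t ∈ L, IsTree t)
    (hP : ∀ t, IsTree t → (t ∈ L ↔ P (toB e t))) :
    IsTreeTestable R L ↔ Testable k comm cca P := by
  have hval := val_toB (k := k) (e := e) fun a => (hk _).2 ⟨a, rfl⟩
  have hsurj := fun x => exists_toB_eq (k := k) (e := e) (fun n => (hk n).1) (x := x)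
  have htypes : ∀ n t t', (∀ s, Val k s → size s ≤ n →
      (PieceRel comm cca s (toB e t) ↔ PieceRel comm cca s (toB e t'))) ↔
      ∀ s : Forest A, forestSize s ≤ n → (R s t ↔ R s t') := fun n t t' => by
    constructor
    · intro h s hs
      rw [hR, hR]
      exact h _ (hval s) (by rwa [← forestSize_eq])
    · intro h x hx hn
      obtain ⟨s, rfl⟩ := hsurj x hx
      rw [← hR, ← hR]
      exact h s (by rwa [forestSize_eq (e := e)])
  constructor
  · rintro ⟨K, ⟨n, hn⟩, rfl⟩
    refine ⟨n, fun x x' hx hx' hs hs' h => ?_⟩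
    obtain ⟨t, rfl⟩ := hsurj x hx
    obtain ⟨t', rfl⟩ := hsurj x' hx'
    rw [← isTree_iff] at hs hs'
    rw [← hP t hs, ← hP t' hs']
    have := hn t t' ((htypes n t t').1 h)
    simp only [Set.mem_inter_iff, Set.mem_ofPred_eq, hs, hs', this]
  · rintro ⟨n, hn⟩
    -- The saturation of `L` under having the same pieces with at most `n` nodes; the condition on
    -- trees ensures that it contains no new trees.
    refine ⟨{t | ∃ t' ∈ L, ∀ s : Forest A, forestSize s ≤ n → (R s t ↔ R s t')}, ⟨n, ?_⟩, ?_⟩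
    · intro t t' h
      constructor
      · rintro ⟨u, hu, h'⟩
        exact ⟨u, hu, fun s hs => (h s hs).symm.trans (h' s hs)⟩
      · rintro ⟨u, hu, h'⟩
        exact ⟨u, hu, fun s hs => (h s hs).trans (h' s hs)⟩
    · ext t
      constructor
      · exact fun h => ⟨⟨t, h, fun _ _ => Iff.rfl⟩, hL t h⟩
      · rintro ⟨⟨u, hu, h⟩, ht⟩
        have ht : IsTree t := ht
        rw [hP t ht, hn _ _ (hval t) (hval u) ((isTree_iff t).1 ht) ((isTree_iff u).1 (hL u hu))
          ((htypes n t u).2 h), ← hP u (hL u hu)]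
        exact hu

end Transfer

-- Finitely many types of forests.

namespace BForest

/-- The forests with labels less than `k` and with at most `N` nodes. -/
def forestsUpTo (k : ℕ) : ℕ → List BForest
  | 0 => [nil]
  | N + 1 => nil :: (List.range k).flatMap fun a => (forestsUpTo k N).flatMap fun c =>
      ((forestsUpTo k N).filter fun s => size c + size s ≤ N).map fun s => node a c s

theorem mem_forestsUpTo {k N : ℕ} {x : BForest} :
    x ∈ forestsUpTo k N ↔ Val k x ∧ size x ≤ N := by
  induction N generalizing x with
  | zero =>
    simp only [forestsUpTo, List.mem_singleton, Nat.le_zero, size_eq_zero]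
    exact ⟨fun h => ⟨by rw [h]; trivial, h⟩, fun h => h.2⟩
  | succ N ih =>
    cases x with
    | nil => simp [forestsUpTo, Val, size]
    | node a c s =>
      simp only [forestsUpTo, List.mem_cons, List.mem_flatMap, List.mem_map, List.mem_filter,
        List.mem_range, ih, reduceCtorEq, false_or, BForest.node.injEq, decide_eq_true_eq, Val, size]
      constructor
      · rintro ⟨_, ha, _, hc, _, hs, rfl, rfl, rfl⟩
        exact ⟨⟨ha, hc.1, hs.1.1⟩, by omega⟩
      · rintro ⟨⟨ha, hc, hs⟩, h⟩
        exact ⟨a, ha, c, ⟨hc, by omega⟩, s, ⟨⟨hs, by omega⟩, by omega⟩, rfl, rfl, rfl⟩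

theorem finite_val_size_le (k N : ℕ) : {x | Val k x ∧ size x ≤ N}.Finite :=
  (forestsUpTo k N).finite_toSet.subset fun _ hx => mem_forestsUpTo.2 hx

/-- A map with finite range attains all its values on forests of bounded size. -/
theorem exists_size_bound_of_finite {T : Type*} {k : ℕ} (θ : BForest → T)
    (hθ : (θ '' {x | Val k x}).Finite) :
    ∃ N, ∀ x, Val k x → ∃ z, Val k z ∧ size z ≤ N ∧ θ z = θ x := by
  have : ∀ t : (θ '' {x | Val k x} : Set T), ∃ z, Val k z ∧ θ z = t := fun ⟨_, x, hx, h⟩ => ⟨x, hx, h⟩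
  choose g hg using this
  have := hθ.to_subtype
  obtain ⟨N, hN⟩ := (Set.finite_range fun t => size (g t)).bddAbove
  exact ⟨N, fun x hx => ⟨g ⟨_, x, hx, rfl⟩, (hg _).1, hN ⟨_, rfl⟩, (hg _).2⟩⟩

/-- `x` and `y` have the same pieces with at most `n` nodes. -/
def SameDown (k n : ℕ) (comm cca : Bool) (x y : BForest) : Prop :=
  ∀ s, Val k s → size s ≤ n → (Emb comm cca s x ↔ Emb comm cca s y)

section SameDown

variable {k n : ℕ} {comm cca : Bool} {x y z c c' s s' : BForest}

theorem SameDown.refl (x : BForest) : SameDown k n comm cca x x := fun _ _ _ => Iff.rfl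

theorem SameDown.symm (h : SameDown k n comm cca x y) : SameDown k n comm cca y x :=
  fun s hs hn => (h s hs hn).symm

theorem SameDown.trans (h : SameDown k n comm cca x y) (h' : SameDown k n comm cca y z) :
    SameDown k n comm cca x z :=
  fun s hs hn => (h s hs hn).trans (h' s hs hn)

/-- The parts of a piece are no larger than the piece, so only pieces of `c` and `s` with at most
`n` nodes matter. This makes `SameDown` a congruence. -/
theorem SameDown.emb_node (a : ℕ) (hc : SameDown k n comm cca c c')
    (hs : SameDown k n comm cca s s') (hx : Val k x) (hn : size x ≤ n)
    (h : Emb comm cca x (BForest.node a c s)) : Emb comm cca x (BForest.node a c' s') := by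
  obtain ⟨x₁, x₂, hm, h2, h1⟩ := h
  have hv := hm.val_iff.1 hx
  have hsz := hm.size_eq
  refine ⟨x₁, x₂, hm, (hs x₂ hv.2 (by omega)).1 h2, ?_⟩
  rcases h1 with ⟨h1, h1'⟩ | ⟨x', rfl, h1⟩
  · exact .inl ⟨h1, (hc x₁ hv.1 (by omega)).1 h1'⟩
  · exact .inr ⟨x', rfl, (hc x' hv.1.2.1 (by simp only [size] at hsz; omega)).1 h1⟩

theorem SameDown.node (a : ℕ) (hc : SameDown k n comm cca c c')
    (hs : SameDown k n comm cca s s') :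
    SameDown k n comm cca (node a c s) (BForest.node a c' s') := fun _ hx hn =>
  ⟨hc.emb_node a hs hx hn, hc.symm.emb_node a hs.symm hx hn⟩

/-- A nonempty forest has a piece with one node; this is why a positive bound is required
throughout. -/
theorem SameDown.eq_nil (h : SameDown k n comm cca x y) (hn : 0 < n) (hy : Val k y)
    (hx : x = nil) : y = nil := by
  subst hx
  cases y with
  | nil => rfl
  | node a c s =>
    have := (h (.node a .nil .nil) ⟨hy.1, trivial, trivial⟩ (by simp only [size]; omega)).2
      (.node a (.nil_left c) (.nil_left s))
    cases this.eq_nil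

theorem SameDown.eq_nil_iff (h : SameDown k n comm cca x y) (hn : 0 < n) (hx : Val k x)
    (hy : Val k y) : x = nil ↔ y = nil :=
  ⟨h.eq_nil hn hy, h.symm.eq_nil hn hx⟩

/-- The set of the pieces of `x` with at most `n` nodes. -/
def downType (k n : ℕ) (comm cca : Bool) (x : BForest) : Set BForest :=
  {s | Val k s ∧ size s ≤ n ∧ Emb comm cca s x}

theorem sameDown_of_downType_eq (h : downType k n comm cca x = downType k n comm cca y) :
    SameDown k n comm cca x y := fun s hs hn => by
  simpa [downType, hs, hn] using Set.ext_iff.1 h s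

theorem downType_mem_powerset (x : BForest) :
    downType k n comm cca x ∈ 𝒫 {x | Val k x ∧ size x ≤ n} :=
  fun _ hs => ⟨hs.1, hs.2.1⟩

end SameDown

section Automaton

/-- Value of a forest under the automaton with the initial state `q` and the transitions `d`. -/
def run (d : ℕ → ℕ → ℕ → ℕ) (q : ℕ) : BForest → ℕ
  | nil => q
  | node a c s => d a (run d q c) (run d q s)

/-- `x` and `y` have the same value, the same pieces with at most `n` nodes, and both or none
of them are trees. -/
def SameType (d : ℕ → ℕ → ℕ → ℕ) (q k n : ℕ) (comm : Bool) (x y : BForest) : Prop :=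
  run d q x = run d q y ∧ (Single x ↔ Single y) ∧ SameDown k n comm true x y

variable {d : ℕ → ℕ → ℕ → ℕ} {q k n : ℕ} {comm : Bool} {x y z c c' s s' : BForest}

theorem SameType.refl (x : BForest) : SameType d q k n comm x x := ⟨rfl, Iff.rfl, .refl x⟩

theorem SameType.symm (h : SameType d q k n comm x y) : SameType d q k n comm y x :=
  ⟨h.1.symm, h.2.1.symm, h.2.2.symm⟩

theorem SameType.trans (h : SameType d q k n comm x y) (h' : SameType d q k n comm y z) :
    SameType d q k n comm x z :=
  ⟨h.1.trans h'.1, h.2.1.trans h'.2.1, h.2.2.trans h'.2.2⟩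

theorem SameType.node (hn : 0 < n) (hs : Val k s) (hs' : Val k s') (a : ℕ)
    (h : SameType d q k n comm c c') (h' : SameType d q k n comm s s') :
    SameType d q k n comm (node a c s) (BForest.node a c' s') :=
  ⟨by simp [run, h.1, h'.1], h'.2.2.eq_nil_iff hn hs hs', h.2.2.node a h'.2.2⟩

theorem finite_sameType {B : ℕ} (hB : ∀ x, run d q x ≤ B) :
    (Set.range fun x => (run d q x, Single x, downType k n comm true x)).Finite := by
  refine (((Set.finite_Iic B).prod ((Set.finite_univ (α := Prop)).prod
    (finite_val_size_le k n).powerset))).subset ?_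
  rintro _ ⟨x, rfl⟩
  exact ⟨hB x, trivial, downType_mem_powerset x⟩

theorem exists_sameType_size_le {B : ℕ} (hB : ∀ x, run d q x ≤ B) (k n : ℕ) (comm : Bool) :
    ∃ N, ∀ x, Val k x → ∃ z, Val k z ∧ size z ≤ N ∧ SameType d q k n comm z x := by
  obtain ⟨N, hN⟩ := exists_size_bound_of_finite (k := k)
    (fun x => (run d q x, Single x, downType k n comm true x))
    ((finite_sameType hB).subset (Set.image_subset_range _ _))
  refine ⟨N, fun x hx => ?_⟩
  obtain ⟨z, hz, hzN, h⟩ := hN x hx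
  simp only [Prod.mk.injEq, eq_iff_iff] at h
  exact ⟨z, hz, hzN, h.1, h.2.1, sameDown_of_downType_eq h.2.2⟩

end Automaton

-- Factorization through small cca-pieces and the certificate of testability.

/-- Number of trees. -/
def width : BForest → ℕ
  | nil => 0
  | node _ _ s => width s + 1

theorem width_app (x y : BForest) : width (app x y) = width x + width y := by
  induction x with
  | nil => simp [width]
  | node a c s _ ih => simp only [node_app, width, ih]; omega

theorem small_of_width_le {x : BForest} (h : width x ≤ 1) : Small x := by
  rcases x with _ | ⟨a, c, _ | _⟩ <;> simp_all [width, Small]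

/-- Besides the nodes of `x`, `u` keeps a removed node only if at least two trees remain below it.
Keeping it adds one to the size but merges these trees into one, so the decrease of `width` pays for
it. -/
theorem Emb.exists_size_le {x t : BForest} (h : Emb false false x t) :
    ∃ u, Emb false false x u ∧ Emb false true u t ∧ size u + width u ≤ 2 * size x := by
  induction t generalizing x with
  | nil => cases h; exact ⟨nil, .refl _, .refl _, by simp [size, width]⟩
  | node a c s ihc ihs =>
    obtain ⟨x₁, x₂, hm, h2, h1⟩ := h
    cases hm
    obtain ⟨u₂, hu₂, hu₂', hsz₂⟩ := ihs h2
    rcases h1 with ⟨_, h1⟩ | ⟨x', rfl, h1⟩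
    · obtain ⟨u₁, hu₁, hu₁', hsz₁⟩ := ihc h1
      by_cases hw : width u₁ ≤ 1
      · refine ⟨_, hu₁.app hu₂, ⟨u₁, u₂, rfl, hu₂', .inl ⟨fun _ => small_of_width_le hw, hu₁'⟩⟩, ?_⟩
        rw [size_app, size_app, width_app]
        omega
      · refine ⟨BForest.node a u₁ u₂, ⟨x₁, x₂, rfl, hu₂, .inl ⟨by simp, hu₁⟩⟩, .node a hu₁' hu₂', ?_⟩
        rw [size_app]
        simp only [size, width]
        omega
    · obtain ⟨u₁, hu₁, hu₁', hsz₁⟩ := ihc h1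
      refine ⟨BForest.node a u₁ u₂, ?_, .node a hu₁' hu₂', ?_⟩
      · exact .node a hu₁ hu₂
      · rw [size_app]
        simp only [size, width] at *
        omega

end BForest

open BForest

variable {comm cca : Bool} {k : ℕ}

theorem PieceRel.exists_size_le {s t : BForest} (h : PieceRel comm cca s t) :
    ∃ u, size u ≤ 2 * size s ∧ Emb false cca s u ∧ Emb comm true u t := by
  obtain ⟨v, h1, h2⟩ := h
  cases cca
  · obtain ⟨u, hu, hu', hsz⟩ := h1.exists_size_le
    exact ⟨u, by omega, hu, hu'.of_cca.trans h2⟩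
  · exact ⟨s, by omega, .refl s, h1.of_cca.trans h2⟩

theorem PieceRel.of_sameDown {n : ℕ} {s t t' : BForest} (ht : Val k t) (hs : 2 * size s ≤ n)
    (h : SameDown k n comm true t t') (h' : PieceRel comm cca s t) : PieceRel comm cca s t' := by
  obtain ⟨u, hsz, h1, h2⟩ := h'.exists_size_le
  exact ⟨u, h1, (h u (h2.val ht) (hsz.trans hs)).1 h2⟩

theorem pieceRel_iff_exists_mem {n : ℕ} {s t : BForest} (hs : size s ≤ n) (ht : Val k t) :
    PieceRel comm cca s t ↔
      ∃ u ∈ forestsUpTo k (2 * n), Emb false cca s u ∧ Emb comm true u t := by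
  constructor
  · intro h
    obtain ⟨u, hsz, h1, h2⟩ := h.exists_size_le
    exact ⟨u, mem_forestsUpTo.2 ⟨h2.val ht, by omega⟩, h1, h2⟩
  · rintro ⟨u, _, h⟩
    exact ⟨u, h⟩

/-- Certificate of testability: up to the type given by the pieces with at most `2 * n + 1` nodes
and by the automaton, all forests have at most `N` nodes, and the trees among these satisfy the
condition for testability with `n`. -/
def PosCert (d : ℕ → ℕ → ℕ → ℕ) (q k : ℕ) (comm cca : Bool) (acc : ℕ → Prop) (n N : ℕ) : Prop :=
  (∀ a < k, ∀ c ∈ forestsUpTo k N, ∀ s ∈ forestsUpTo k N, ∃ z ∈ forestsUpTo k N,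
    run d q z = run d q (node a c s) ∧ (Single z ↔ Single (node a c s)) ∧
    ∀ x ∈ forestsUpTo k (2 * n + 1), Emb comm true x z ↔ Emb comm true x (node a c s)) ∧
  ∀ t ∈ forestsUpTo k N, ∀ t' ∈ forestsUpTo k N, Single t → Single t' →
    (∀ s ∈ forestsUpTo k n,
      (∃ u ∈ forestsUpTo k (2 * n), Emb false cca s u ∧ Emb comm true u t) ↔
      ∃ u ∈ forestsUpTo k (2 * n), Emb false cca s u ∧ Emb comm true u t') →
    (acc (run d q t) ↔ acc (run d q t'))

/-- Pieces with at most `n` nodes are determined by cca-pieces with at most `2 * n` nodes, hence by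
the type; `+ 1` keeps the bound positive if `n = 0`. There are finitely many types, so
representatives of some bounded size `N` exist, and closure under `node` is enough to verify that a
given `N` works. -/
theorem testable_iff_exists_posCert {d : ℕ → ℕ → ℕ → ℕ} {q B : ℕ} (hB : ∀ x, run d q x ≤ B)
    (acc : ℕ → Prop) :
    Testable k comm cca (fun t => acc (run d q t)) ↔ ∃ n N, PosCert d q k comm cca acc n N := by
  have key : ∀ n t t', Val k t → Val k t' → ((∀ s ∈ forestsUpTo k n,
      (∃ u ∈ forestsUpTo k (2 * n), Emb false cca s u ∧ Emb comm true u t) ↔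
      ∃ u ∈ forestsUpTo k (2 * n), Emb false cca s u ∧ Emb comm true u t') ↔
      ∀ s, Val k s → size s ≤ n → (PieceRel comm cca s t ↔ PieceRel comm cca s t')) := by
    intro n t t' ht ht'
    simp only [mem_forestsUpTo (x := _) (N := n), and_imp]
    refine forall_congr' fun s => forall_congr' fun _ => forall_congr' fun hs => ?_
    rw [pieceRel_iff_exists_mem hs ht, pieceRel_iff_exists_mem hs ht']
  constructor
  · rintro ⟨n, hn⟩
    obtain ⟨N, hN⟩ := exists_sameType_size_le hB k (2 * n + 1) comm
    refine ⟨n, N, fun a ha c hc s hs => ?_, fun t ht t' ht' hst hst' h => ?_⟩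
    · rw [mem_forestsUpTo] at hc hs
      obtain ⟨z, hz, hzN, h⟩ := hN (node a c s) ⟨ha, hc.1, hs.1⟩
      exact ⟨z, mem_forestsUpTo.2 ⟨hz, hzN⟩, h.1, h.2.1, fun x hx =>
        h.2.2 x (mem_forestsUpTo.1 hx).1 (mem_forestsUpTo.1 hx).2⟩
    · rw [mem_forestsUpTo] at ht ht'
      exact hn t t' ht.1 ht'.1 hst hst' ((key n t t' ht.1 ht'.1).1 h)
  · rintro ⟨n, N, hclosed, hcheck⟩
    have hrep : ∀ x, Val k x → ∃ z ∈ forestsUpTo k N, SameType d q k (2 * n + 1) comm z x := by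
      intro x hx
      induction x with
      | nil => exact ⟨nil, mem_forestsUpTo.2 ⟨trivial, Nat.zero_le _⟩, .refl _⟩
      | node a c s ihc ihs =>
        obtain ⟨c', hc', h1⟩ := ihc hx.2.1
        obtain ⟨s', hs', h2⟩ := ihs hx.2.2
        obtain ⟨z, hz, h3, h4, h5⟩ := hclosed a hx.1 c' hc' s' hs'
        refine ⟨z, hz, SameType.trans ⟨h3, h4, fun x hx hn => h5 x (mem_forestsUpTo.2 ⟨hx, hn⟩)⟩
          (.node (by omega) (mem_forestsUpTo.1 hs').1 hx.2.2 a h1 h2)⟩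
    refine ⟨n, fun t t' ht ht' hst hst' h => ?_⟩
    obtain ⟨z, hz, h1⟩ := hrep t ht
    obtain ⟨z', hz', h2⟩ := hrep t' ht'
    have hvz := (mem_forestsUpTo.1 hz).1
    have hvz' := (mem_forestsUpTo.1 hz').1
    dsimp only
    rw [← h1.1, ← h2.1]
    refine hcheck z hz z' hz' (h1.2.1.2 hst) (h2.2.1.2 hst') ((key n z z' hvz hvz').2 ?_)
    intro s hs hn
    constructor
    · intro hp
      exact ((h s hs hn).1 (hp.of_sameDown hvz (by omega) h1.2.2)).of_sameDown ht' (by omega)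
        h2.2.2.symm
    · intro hp
      exact ((h s hs hn).2 (hp.of_sameDown hvz' (by omega) h2.2.2)).of_sameDown ht (by omega)
        h1.2.2.symm

-- Decompositions of forests and certificates of directedness.

namespace BForest

/-- All pairs whose concatenation (`comm = false`) or interleaving (`comm = true`) is the
given forest. -/
def splits (comm : Bool) : BForest → List (BForest × BForest)
  | nil => [(nil, nil)]
  | node a c s =>
    (if comm then (splits comm s).map fun p => (p.1, node a c p.2) else [(nil, node a c s)]) ++
      (splits comm s).map fun p => (node a c p.1, p.2)

theorem mem_splits {comm : Bool} {x : BForest} {p : BForest × BForest} :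
    p ∈ splits comm x ↔ Mix comm p.1 p.2 x := by
  induction x generalizing p with
  | nil =>
    rw [splits, List.mem_singleton]
    constructor
    · rintro rfl
      exact .nil_left nil
    · intro h
      have h := h.size_eq
      simp only [size] at h
      exact Prod.ext (size_eq_zero.1 (by omega)) (size_eq_zero.1 (by omega))
  | node a c s _ ih =>
    obtain ⟨u, v⟩ := p
    cases comm
    · simp only [splits, Bool.false_eq_true, if_false, List.mem_append, List.mem_singleton,
        List.mem_map, Prod.mk.injEq, Prod.exists, ih, Mix]
      constructor
      · rintro (⟨rfl, rfl⟩ | ⟨u, v, rfl, rfl, rfl⟩) <;> rfl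
      · intro h
        cases u with
        | nil => exact .inl ⟨rfl, h.symm⟩
        | node b d u =>
          simp only [node_app, BForest.node.injEq] at h
          obtain ⟨rfl, rfl, h⟩ := h
          exact .inr ⟨u, v, h, rfl, rfl⟩
    · simp only [splits, if_true, List.mem_append, List.mem_map, Prod.mk.injEq, Prod.exists, ih,
        Mix]
      constructor
      · rintro (⟨u, v, h, rfl, rfl⟩ | ⟨u, v, h, rfl, rfl⟩)
        · exact .right a c h
        · exact .left a c h
      · intro h
        cases h with
        | left _ _ h => exact .inr ⟨_, _, h, rfl, rfl⟩
        | right _ _ h => exact .inl ⟨_, _, h, rfl, rfl⟩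

/-- Label of the first root. -/
def label : BForest → ℕ
  | nil => 0
  | node a _ _ => a

/-- Forest below the first root. -/
def child : BForest → BForest
  | nil => nil
  | node _ c _ => c

theorem Single.eq_node {x : BForest} (h : Single x) : x = node (label x) (child x) nil := by
  cases x with
  | nil => exact h.elim
  | node a c s => cases h; rfl

theorem Val.child {k : ℕ} {x : BForest} (h : Val k x) : Val k (child x) := by
  cases x with
  | nil => trivial
  | node a c s => exact h.2.1

/-- Same small pieces, and if `x` is a tree then so is `y`, with the same root label and the
same small pieces below the root. -/
def Similar (k m : ℕ) (x y : BForest) : Prop :=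
  SameDown k m false true x y ∧ (Single x → Single y ∧ label x = label y ∧
    SameDown k m false true (child x) (child y))

/-- Every decomposition of `x` is matched by a decomposition of `y` with similar parts. -/
def Refines (k m : ℕ) (comm : Bool) (x y : BForest) : Prop :=
  ∀ p ∈ splits comm x, ∃ p' ∈ splits comm y,
    Similar k m p.1 p'.1 ∧ SameDown k m false true p.2 p'.2

section Refines

variable {k m : ℕ} {comm cca : Bool} {x y z c c' s s' : BForest}

theorem Similar.refl (x : BForest) : Similar k m x x := ⟨.refl x, fun h => ⟨h, rfl, .refl _⟩⟩

theorem Similar.trans (h : Similar k m x y) (h' : Similar k m y z) : Similar k m x z :=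
  ⟨h.1.trans h'.1, fun hx => have h1 := h.2 hx; have h2 := h'.2 h1.1
    ⟨h2.1, h1.2.1.trans h2.2.1, h1.2.2.trans h2.2.2⟩⟩

theorem Similar.small (hm : 0 < m) (h : Similar k m x y) (hy : Val k y) (hx : Small x) :
    Small y := by
  rw [small_iff] at *
  exact hx.imp (h.1.eq_nil hm hy) fun hx => (h.2 hx).1

theorem Refines.refl (x : BForest) : Refines k m comm x x :=
  fun p hp => ⟨p, hp, .refl _, .refl _⟩

theorem Refines.trans (h : Refines k m comm x y) (h' : Refines k m comm y z) :
    Refines k m comm x z := fun p hp => by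
  obtain ⟨p', hp', h1, h2⟩ := h p hp
  obtain ⟨p'', hp'', h3, h4⟩ := h' p' hp'
  exact ⟨p'', hp'', h1.trans h3, h2.trans h4⟩

theorem val_of_mem_splits {p : BForest × BForest} (hx : Val k x) (hp : p ∈ splits comm x) :
    Val k p.1 ∧ Val k p.2 :=
  (mem_splits.1 hp).val_iff.1 hx

/-- The decomposition of `x` into `nil` and `x` can be matched only by that of `y` into `nil` and
`y`. -/
theorem Refines.sameDown (hm : 0 < m) (hy : Val k y) (h : Refines k m comm x y) :
    SameDown k m false true x y := by
  obtain ⟨⟨u, v⟩, hp, h1, h2⟩ := h (nil, x) (mem_splits.2 (.nil_left x))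
  have hu := h1.1.eq_nil hm (val_of_mem_splits hy hp).1 rfl
  dsimp only at hu
  subst hu
  rw [(mem_splits.1 hp).eq_of_nil_left]
  exact h2

/-- Compatibility with `node` lets the finite condition `DirCert.closed` yield representatives of
all forests, in `DirCert.exists_rep`. -/
theorem Refines.node (hm : 0 < m) (hs' : Val k s') (a : ℕ) (hc : SameDown k m false true c c')
    (hs : Refines k m comm s s') : Refines k m comm (node a c s) (BForest.node a c' s') := by
  have left : ∀ p ∈ splits comm s, ∃ p' ∈ splits comm (BForest.node a c' s'),
      Similar k m (BForest.node a c p.1) p'.1 ∧ SameDown k m false true p.2 p'.2 := by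
    intro p hp
    obtain ⟨p', hp', h1, h2⟩ := hs p hp
    refine ⟨(BForest.node a c' p'.1, p'.2), ?_, ⟨hc.node a h1.1, fun h => ⟨?_, rfl, hc⟩⟩, h2⟩
    · rw [splits]
      exact List.mem_append_right _ (List.mem_map.2 ⟨p', hp', rfl⟩)
    · exact h1.1.eq_nil hm (val_of_mem_splits hs' hp').1 h
  intro p hp
  rw [splits, List.mem_append, List.mem_map] at hp
  rcases hp with hp | ⟨p, hp, rfl⟩
  · cases comm
    · simp only [Bool.false_eq_true, if_false, List.mem_singleton] at hp
      subst hp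
      exact ⟨(nil, BForest.node a c' s'), by simp [splits], .refl _,
        hc.node a (hs.sameDown hm hs')⟩
    · simp only [if_true, List.mem_map] at hp
      obtain ⟨p, hp, rfl⟩ := hp
      obtain ⟨p', hp', h1, h2⟩ := hs p hp
      refine ⟨(p'.1, BForest.node a c' p'.2), ?_, h1, hc.node a h2⟩
      rw [splits]
      exact List.mem_append_left _ (List.mem_map.2 ⟨p', hp', rfl⟩)
  · exact left p hp

/-- A finite invariant that determines the relation `Refines`. -/
def splitType (k m : ℕ) (comm : Bool) (x : BForest) :
    Set ((Set BForest × Prop × ℕ × Set BForest) × Set BForest) :=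
  {t | ∃ p ∈ splits comm x, t = ((downType k m false true p.1, Single p.1, label p.1,
    downType k m false true (child p.1)), downType k m false true p.2)}

theorem refines_of_splitType_eq (h : splitType k m comm x = splitType k m comm y) :
    Refines k m comm x y := by
  intro p hp
  have : _ ∈ splitType k m comm x := ⟨p, hp, rfl⟩
  rw [h] at this
  obtain ⟨p', hp', h⟩ := this
  simp only [Prod.mk.injEq, eq_iff_iff] at h
  obtain ⟨⟨h1, h2, h3, h4⟩, h5⟩ := h
  exact ⟨p', hp', ⟨sameDown_of_downType_eq h1, fun h => ⟨h2.1 h, h3, sameDown_of_downType_eq h4⟩⟩,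
    sameDown_of_downType_eq h5⟩

theorem label_le (hx : Val k x) : label x ≤ k := by
  cases x with
  | nil => exact Nat.zero_le k
  | node a c s => exact hx.1.le

theorem finite_splitType (k m : ℕ) (comm : Bool) :
    (splitType k m comm '' {x | Val k x}).Finite := by
  have hfin := (finite_val_size_le k m).powerset
  refine Set.Finite.subset ((hfin.prod ((Set.finite_univ (α := Prop)).prod
    ((Set.finite_Iic k).prod hfin))).prod hfin).powerset ?_
  rintro _ ⟨x, hx, rfl⟩ _ ⟨p, hp, rfl⟩
  exact ⟨⟨downType_mem_powerset _, trivial, label_le (val_of_mem_splits hx hp).1,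
    downType_mem_powerset _⟩, downType_mem_powerset _⟩

end Refines

/-- Certificate that any two forests `x` and `y` with the properties `I` and `J` have a common
upper bound for `Emb comm' cca` with the property `K`. -/
structure DirCert (d : ℕ → ℕ → ℕ → ℕ) (q k n : ℕ) (comm comm' cca : Bool)
    (I J K : BForest → Prop) (m N M : ℕ) : Prop where
  pos : 0 < m
  closed : ∀ a < k, ∀ c ∈ forestsUpTo k N, ∀ s ∈ forestsUpTo k N, ∃ z ∈ forestsUpTo k N,
    SameType d q k n comm z (node a c s) ∧ Refines k m comm' z (node a c s)
  transfer : ∀ w ∈ forestsUpTo k N, ∀ w' ∈ forestsUpTo k N, ∀ z ∈ forestsUpTo k N,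
    ∀ z' ∈ forestsUpTo k N, SameDown k m false true w z → SameDown k m false true w' z' →
    ∀ t ∈ forestsUpTo k M, Emb comm' cca z t → Emb comm' cca z' t →
    ∃ t' ∈ forestsUpTo k M, Emb comm' cca w t' ∧ Emb comm' cca w' t' ∧ SameType d q k n comm t' t
  bound : ∀ z ∈ forestsUpTo k N, ∀ z' ∈ forestsUpTo k N, I z → J z' →
    ∃ t ∈ forestsUpTo k M, K t ∧ Emb comm' cca z t ∧ Emb comm' cca z' t

section DirCert

variable {d : ℕ → ℕ → ℕ → ℕ} {q k n m N M : ℕ} {comm comm' cca : Bool}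
  {I J K : BForest → Prop}

theorem DirCert.exists_rep (h : DirCert d q k n comm comm' cca I J K m N M) (hn : 0 < n)
    {x : BForest} (hx : Val k x) :
    ∃ z ∈ forestsUpTo k N, SameType d q k n comm z x ∧ Refines k m comm' z x := by
  induction x with
  | nil => exact ⟨nil, mem_forestsUpTo.2 ⟨trivial, Nat.zero_le _⟩, .refl _, .refl _⟩
  | node a c s ihc ihs =>
    obtain ⟨c', hc', h1, h2⟩ := ihc hx.2.1
    obtain ⟨s', hs', h3, h4⟩ := ihs hx.2.2
    obtain ⟨z, hz, h5, h6⟩ := h.closed a hx.1 c' hc' s' hs'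
    exact ⟨z, hz, h5.trans (.node hn (mem_forestsUpTo.1 hs').1 hx.2.2 a h1 h3),
      h6.trans (.node h.pos hx.2.2 a (h2.sameDown h.pos hx.2.1) h4)⟩

/-- The way in which the part `z` of a piece is embedded into a tree is followed by any similar
part `x`. -/
theorem Similar.exists_below {x z c : BForest} {a : ℕ} (hm : 0 < m) (hx : Val k x)
    (h : Similar k m z x) (hz : ((cca = true → Small z) ∧ Emb comm' cca z c) ∨
      ∃ z', z = node a z' nil ∧ Emb comm' cca z' c) :
    ∃ u v, SameDown k m false true v u ∧ Emb comm' cca v c ∧ size u ≤ size x ∧ size v ≤ size z ∧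
      Val k u ∧ (Val k z → Val k v) ∧ (size u = size x → u = x ∧ v = z) ∧ ∀ c', Emb comm' cca u c' →
      ((cca = true → Small x) ∧ Emb comm' cca x c') ∨
        ∃ x', x = node a x' nil ∧ Emb comm' cca x' c' := by
  rcases hz with ⟨hz, hzc⟩ | ⟨z', rfl, hz⟩
  · exact ⟨x, z, h.1, hzc, le_rfl, le_rfl, hx, id, fun _ => ⟨rfl, rfl⟩,
      fun c' hc' => .inl ⟨fun hc => h.small hm hx (hz hc), hc'⟩⟩
  · obtain ⟨h1, h2, h3⟩ := h.2 rfl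
    have hxe := h1.eq_node
    rw [← h2] at hxe
    have hsz : size x = size (child x) + 1 := by
      rw [hxe]
      simp [size, child]
    exact ⟨child x, z', h3, hz, by omega, by simp only [size]; omega,
      hx.child, fun hz => hz.2.1, by omega,
      fun c' hc' => .inr ⟨child x, hxe, hc'⟩⟩

/-- An upper bound `t` of the representatives `z` and `z'` is rebuilt into one of `x` and `y`, by
induction on `size x + size y` and, inside, on `t`. The embeddings into `t = node a c s` split `z`
and `z'`, and `Refines` splits `x` and `y` alike. If the parts belonging to `s` are smaller than `x`
and `y` in total, the outer induction applies to them; otherwise they are `x` and `y` themselves,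
`z` and `z'` embed into `s`, and the inner induction applies. The same holds for `c`. Since the
types of `c` and `s` are preserved, so is that of `t`. -/
theorem DirCert.exists_upper_bound (h : DirCert d q k n comm comm' cca I J K m N M) (hn : 0 < n)
    (L : ℕ) : ∀ x y : BForest, size x + size y = L → Val k x → Val k y →
    ∀ t ∈ forestsUpTo k M, ∀ z ∈ forestsUpTo k N, ∀ z' ∈ forestsUpTo k N,
    Refines k m comm' z x → Refines k m comm' z' y → Emb comm' cca z t → Emb comm' cca z' t →
    ∃ t', Val k t' ∧ Emb comm' cca x t' ∧ Emb comm' cca y t' ∧ SameType d q k n comm t' t := by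
  induction L using Nat.strong_induction_on with
  | _ L IH =>
  intro x y hL hx hy
  -- The parts `v`, `v'` of the representatives share only small pieces with `u`, `u'`, whereas the
  -- induction hypothesis asks for `Refines`. The field `transfer` exchanges them for genuine
  -- representatives of `u` and `u'` without changing the type of the bound.
  have step : ∀ u u' v v' t, Val k u → Val k u' → v ∈ forestsUpTo k N → v' ∈ forestsUpTo k N →
      t ∈ forestsUpTo k M → SameDown k m false true v u → SameDown k m false true v' u' →
      Emb comm' cca v t → Emb comm' cca v' t → size u + size u' < L →
      ∃ t', Val k t' ∧ Emb comm' cca u t' ∧ Emb comm' cca u' t' ∧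
        SameType d q k n comm t' t := by
    intro u u' v v' t hu hu' hv hv' ht hvu hvu' hvt hvt' hlt
    obtain ⟨r, hr, _, hru⟩ := h.exists_rep hn hu
    obtain ⟨r', hr', _, hru'⟩ := h.exists_rep hn hu'
    obtain ⟨t₁, ht₁, h1, h2, h3⟩ := h.transfer r hr r' hr' v hv v' hv'
      ((hru.sameDown h.pos hu).trans hvu.symm) ((hru'.sameDown h.pos hu').trans hvu'.symm)
      t ht hvt hvt'
    obtain ⟨t', ht', h4, h5, h6⟩ := IH _ hlt u u' rfl hu hu' t₁ ht₁ r hr r' hr' hru hru' h1 h2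
    exact ⟨t', ht', h4, h5, h6.trans h3⟩
  intro t ht z hz z' hz' hzx hzy hzt hzt'
  have memN : ∀ {comm' : Bool} {z z₁ z₂ : BForest}, z ∈ forestsUpTo k N → Mix comm' z₁ z₂ z →
      z₁ ∈ forestsUpTo k N ∧ z₂ ∈ forestsUpTo k N := by
    intro _ z z₁ z₂ hz hmix
    have hsz := hmix.size_eq
    rw [mem_forestsUpTo] at hz
    have hv := hmix.val_iff.1 hz.1
    exact ⟨mem_forestsUpTo.2 ⟨hv.1, by omega⟩, mem_forestsUpTo.2 ⟨hv.2, by omega⟩⟩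
  induction t with
  | nil =>
    cases hzt
    cases hzt'
    have hx0 := (hzx.sameDown h.pos hx).eq_nil h.pos hx rfl
    have hy0 := (hzy.sameDown h.pos hy).eq_nil h.pos hy rfl
    exact ⟨nil, trivial, hx0 ▸ .refl _, hy0 ▸ .refl _, .refl _⟩
  | node a c s ihc ihs =>
    have ht' := mem_forestsUpTo.1 ht
    simp only [Val, size] at ht'
    have hc : c ∈ forestsUpTo k M := mem_forestsUpTo.2 ⟨ht'.1.2.1, by omega⟩
    have hs : s ∈ forestsUpTo k M := mem_forestsUpTo.2 ⟨ht'.1.2.2, by omega⟩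
    obtain ⟨z₁, z₂, hmz, hz₂, hz₁⟩ := hzt
    obtain ⟨z₁', z₂', hmz', hz₂', hz₁'⟩ := hzt'
    obtain ⟨⟨x₁, x₂⟩, hpx, hsx₁, hsx₂⟩ := hzx (z₁, z₂) (mem_splits.2 hmz)
    obtain ⟨⟨y₁, y₂⟩, hpy, hsy₁, hsy₂⟩ := hzy (z₁', z₂') (mem_splits.2 hmz')
    have hmx : Mix comm' x₁ x₂ x := mem_splits.1 hpx
    have hmy : Mix comm' y₁ y₂ y := mem_splits.1 hpy
    obtain ⟨hvx₁, hvx₂⟩ := hmx.val_iff.1 hx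
    obtain ⟨hvy₁, hvy₂⟩ := hmy.val_iff.1 hy
    have hszx := hmx.size_eq
    have hszy := hmy.size_eq
    dsimp only at hsx₁ hsx₂ hsy₁ hsy₂
    have hNz := memN hz hmz
    have hNz' := memN hz' hmz'
    obtain ⟨s', hs', hxs, hys, hss⟩ : ∃ s', Val k s' ∧ Emb comm' cca x₂ s' ∧ Emb comm' cca y₂ s' ∧
        SameType d q k n comm s' s := by
      by_cases hlt : size x₂ + size y₂ < L
      · exact step x₂ y₂ z₂ z₂' s hvx₂ hvy₂ hNz.2 hNz'.2 hs hsx₂ hsy₂ hz₂ hz₂' hlt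
      -- Nothing of `x` or `y` goes to the first tree; positivity of `m` carries this over to `z`
      -- and `z'`.
      · have hx₁ : x₁ = nil := size_eq_zero.1 (by omega)
        have hy₁ : y₁ = nil := size_eq_zero.1 (by omega)
        have hz₁0 := hsx₁.1.symm.eq_nil h.pos (mem_forestsUpTo.1 hNz.1).1 hx₁
        have hz₁0' := hsy₁.1.symm.eq_nil h.pos (mem_forestsUpTo.1 hNz'.1).1 hy₁
        subst hx₁ hy₁ hz₁0 hz₁0'
        rw [← hmx.eq_of_nil_left, ← hmy.eq_of_nil_left]
        rw [← hmz.eq_of_nil_left] at hz₂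
        rw [← hmz'.eq_of_nil_left] at hz₂'
        exact ihs hs hz₂ hz₂'
    obtain ⟨u, v, hvu, hvc, hux, hvz, hvu1, hvv1, hueq, hu⟩ := hsx₁.exists_below h.pos hvx₁ hz₁
    obtain ⟨u', v', hvu', hvc', huy, hvz', hvu1', hvv1', hueq', hu'⟩ := hsy₁.exists_below h.pos hvy₁ hz₁'
    have hNv : v ∈ forestsUpTo k N := by
      have := mem_forestsUpTo.1 hNz.1
      exact mem_forestsUpTo.2 ⟨hvv1 this.1, hvz.trans this.2⟩
    have hNv' : v' ∈ forestsUpTo k N := by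
      have := mem_forestsUpTo.1 hNz'.1
      exact mem_forestsUpTo.2 ⟨hvv1' this.1, hvz'.trans this.2⟩
    obtain ⟨c', hc', hxc, hyc, hcc⟩ : ∃ c', Val k c' ∧ Emb comm' cca u c' ∧ Emb comm' cca u' c' ∧
        SameType d q k n comm c' c := by
      by_cases hlt : size u + size u' < L
      · exact step u u' v v' c hvu1 hvu1' hNv hNv' hc hvu hvu' hvc hvc' hlt
      · have hx₂ : x₂ = nil := size_eq_zero.1 (by omega)
        have hy₂ : y₂ = nil := size_eq_zero.1 (by omega)
        have hz₂0 := hsx₂.symm.eq_nil h.pos (mem_forestsUpTo.1 hNz.2).1 hx₂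
        have hz₂0' := hsy₂.symm.eq_nil h.pos (mem_forestsUpTo.1 hNz'.2).1 hy₂
        -- Equality of sizes excludes that the root `a` is matched, as that would make `u` smaller
        -- than `x₁`.
        obtain ⟨rfl, rfl⟩ := hueq (by omega)
        obtain ⟨rfl, rfl⟩ := hueq' (by omega)
        subst hx₂ hy₂ hz₂0 hz₂0'
        rw [← hmx.eq_of_nil_right, ← hmy.eq_of_nil_right]
        rw [← hmz.eq_of_nil_right] at hvc
        rw [← hmz'.eq_of_nil_right] at hvc'
        exact ihc hc hvc hvc'
    exact ⟨.node a c' s', ⟨ht'.1.1, hc', hs'⟩, ⟨x₁, x₂, hmx, hxs, hu c' hxc⟩,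
      ⟨y₁, y₂, hmy, hys, hu' c' hyc⟩, .node hn hs' ht'.1.2.2 a hcc hss⟩

/-- Any two forests with the properties `I` and `J` have a common upper bound with the
property `K`. -/
def Dir (k : ℕ) (comm cca : Bool) (I J K : BForest → Prop) : Prop :=
  ∀ x y, Val k x → Val k y → I x → J y → ∃ z, Val k z ∧ K z ∧ Emb comm cca x z ∧ Emb comm cca y z

/-- A property of forests that depends only on the type. -/
def TypeInvariant (d : ℕ → ℕ → ℕ → ℕ) (q k n : ℕ) (comm : Bool) (I : BForest → Prop) : Prop :=
  ∀ x y, Val k x → Val k y → SameType d q k n comm x y → I x → I y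

theorem DirCert.dir (h : DirCert d q k n comm comm' cca I J K m N M) (hn : 0 < n)
    (hI : TypeInvariant d q k n comm I) (hJ : TypeInvariant d q k n comm J)
    (hK : TypeInvariant d q k n comm K) : Dir k comm' cca I J K := by
  intro x y hx hy hIx hJy
  obtain ⟨z, hz, hzx, hzx'⟩ := h.exists_rep hn hx
  obtain ⟨w, hw, hwy, hwy'⟩ := h.exists_rep hn hy
  obtain ⟨t, ht, hKt, h1, h2⟩ := h.bound z hz w hw
    (hI x z hx (mem_forestsUpTo.1 hz).1 hzx.symm hIx)
    (hJ y w hy (mem_forestsUpTo.1 hw).1 hwy.symm hJy)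
  obtain ⟨t', ht', h3, h4, h5⟩ := h.exists_upper_bound hn _ x y rfl hx hy t ht z hz w hw
    hzx' hwy' h1 h2
  exact ⟨t', ht', hK t t' (mem_forestsUpTo.1 ht).1 ht' h5.symm hKt, h3, h4⟩

/-- For each of the finitely many types, the pairs without a common upper bound of this type have
minimal elements of size at most `m`. So pairs with the same pieces up to `m` have upper bounds of
the same types, which gives `transfer`. `N` bounds representatives for the type together with
`splitType`, and `M` bounds chosen upper bounds for the finitely many pairs of forests up to size
`N`. -/
theorem exists_dirCert {B : ℕ} (hB : ∀ x, run d q x ≤ B) (h : Dir k comm' cca I J K) :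
    ∃ m N M, DirCert d q k n comm comm' cca I J K m N M := by
  classical
  let θ : BForest → ℕ × Prop × Set BForest :=
    fun x => (run d q x, Single x, downType k n comm true x)
  have hθ : (Set.range θ).Finite := finite_sameType hB
  have hθs : ∀ x y, θ x = θ y → SameType d q k n comm x y := fun x y h => by
    simp only [θ, Prod.mk.injEq, eq_iff_iff] at h
    exact ⟨h.1, h.2.1, sameDown_of_downType_eq h.2.2⟩
  obtain ⟨m, hm⟩ : ∃ m, ∀ t x y, Val k x → Val k y →
      (¬ ∃ t', Val k t' ∧ θ t' = θ t ∧ Emb comm' cca x t' ∧ Emb comm' cca y t') →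
      ∃ x' y', size x' ≤ m ∧ size y' ≤ m ∧ Emb false true x' x ∧ Emb false true y' y ∧
      ¬ ∃ t', Val k t' ∧ θ t' = θ t ∧ Emb comm' cca x' t' ∧ Emb comm' cca y' t' := by
    let U : Set.range θ → Set (BForest × BForest) := fun τ => {p | Val k p.1 ∧ Val k p.2 ∧
      ¬ ∃ t', Val k t' ∧ θ t' = τ ∧ Emb comm' cca p.1 t' ∧ Emb comm' cca p.2 t'}
    choose g hg using fun τ => exists_size_bound_pair (k := k) (U τ) fun p hp => ⟨hp.1, hp.2.1⟩
    have := hθ.to_subtype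
    obtain ⟨m, hm⟩ := (Set.finite_range g).bddAbove
    refine ⟨m, fun t x y hx hy hn => ?_⟩
    obtain ⟨p, hp, h1, h2, h3, h4⟩ := hg ⟨θ t, t, rfl⟩ (x, y) ⟨hx, hy, hn⟩
    exact ⟨p.1, p.2, h1.trans (hm ⟨_, rfl⟩), h2.trans (hm ⟨_, rfl⟩), h3, h4, hp.2.2⟩
  obtain ⟨N, hN⟩ := exists_size_bound_of_finite (k := k)
    (fun x => (θ x, splitType k (m + 1) comm' x)) (((hθ.prod
      (finite_splitType k (m + 1) comm')).subset (by
        rintro _ ⟨x, hx, rfl⟩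
        exact ⟨⟨x, rfl⟩, x, hx, rfl⟩)))
  have hfin := finite_val_size_le k N
  let Q : BForest → BForest → (ℕ × Prop × Set BForest) → BForest → Prop := fun x y τ t =>
    Val k t ∧ θ t = τ ∧ Emb comm' cca x t ∧ Emb comm' cca y t
  let W : BForest → BForest → (ℕ × Prop × Set BForest) → ℕ := fun x y τ =>
    if h : ∃ t, Q x y τ t then size h.choose else 0
  let Q' : BForest → BForest → BForest → Prop := fun x y t =>
    Val k t ∧ K t ∧ Emb comm' cca x t ∧ Emb comm' cca y t
  let W' : BForest → BForest → ℕ := fun x y => if h : ∃ t, Q' x y t then size h.choose else 0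
  obtain ⟨M, hM⟩ : ∃ M, ∀ x y t, Val k x → size x ≤ N → Val k y → size y ≤ N → 
      W x y (θ t) ≤ M := by
    obtain ⟨M, hM⟩ := (((hfin.prod (hfin.prod hθ)).image fun p => W p.1 p.2.1 p.2.2)).bddAbove
    exact ⟨M, fun x y t hx hx' hy hy' =>
      hM ⟨(x, y, θ t), ⟨⟨hx, hx'⟩, ⟨hy, hy'⟩, t, rfl⟩, rfl⟩⟩
  obtain ⟨M', hM'⟩ : ∃ M, ∀ x y, Val k x → size x ≤ N → Val k y → size y ≤ N → W' x y ≤ M := by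
    obtain ⟨M, hM⟩ := ((hfin.prod hfin).image fun p => W' p.1 p.2).bddAbove
    exact ⟨M, fun x y hx hx' hy hy' => hM ⟨(x, y), ⟨⟨hx, hx'⟩, ⟨hy, hy'⟩⟩, rfl⟩⟩
  -- `m + 1` instead of `m` only for positivity; `M` serves `transfer` and `M'` serves `bound`.
  refine ⟨m + 1, N, max M M', m.succ_pos, ?_, ?_, ?_⟩
  · intro a ha c hc s hs
    obtain ⟨z, hz, hzN, h⟩ := hN (node a c s)
      ⟨ha, (mem_forestsUpTo.1 hc).1, (mem_forestsUpTo.1 hs).1⟩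
    simp only [Prod.mk.injEq] at h
    exact ⟨z, mem_forestsUpTo.2 ⟨hz, hzN⟩, hθs _ _ h.1, refines_of_splitType_eq h.2⟩
  · intro w hw w' hw' z hz z' hz' hwz hwz' t ht hzt hzt'
    rw [mem_forestsUpTo] at hw hw' hz hz' ht
    have hex : ∃ t', Q w w' (θ t) t' := by
      by_contra hno
      obtain ⟨x', y', h1, h2, h3, h4, h5⟩ := hm t w w' hw.1 hw'.1 hno
      exact h5 ⟨t, ht.1, rfl,
        (((hwz x' (h3.val hw.1) (by omega)).1 h3).of_cca).trans hzt,
        (((hwz' y' (h4.val hw'.1) (by omega)).1 h4).of_cca).trans hzt'⟩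
    have hle := hM w w' t hw.1 hw.2 hw'.1 hw'.2
    simp only [W, dif_pos hex] at hle
    obtain ⟨h1, h2, h3, h4⟩ := hex.choose_spec
    exact ⟨hex.choose, mem_forestsUpTo.2 ⟨h1, hle.trans (le_max_left _ _)⟩, h3, h4, hθs _ _ h2⟩
  · intro z hz z' hz' hIz hJz
    rw [mem_forestsUpTo] at hz hz'
    have hex : ∃ t, Q' z z' t := h z z' hz.1 hz'.1 hIz hJz
    have hle := hM' z z' hz.1 hz.2 hz'.1 hz'.2
    simp only [W', dif_pos hex] at hle
    obtain ⟨h1, h2, h3, h4⟩ := hex.choose_spec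
    exact ⟨hex.choose, mem_forestsUpTo.2 ⟨h1, hle.trans (le_max_right _ _)⟩, h2, h3, h4⟩

end DirCert

end BForest

-- Ideals of forests and the failure of testability.

namespace BForest

/-- The pieces of `x` with at most `n` nodes are pieces of `y`. -/
def Sub (k n : ℕ) (comm : Bool) (x y : BForest) : Prop :=
  ∀ s, Val k s → size s ≤ n → Emb comm true s x → Emb comm true s y

variable {d : ℕ → ℕ → ℕ → ℕ} {q k n B : ℕ} {comm cca : Bool}

theorem typeInvariant_sub (y : BForest) :
    TypeInvariant d q k n comm (fun x => Sub k n comm x y) :=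
  fun _ _ _ _ h hx s hs hn he => hx s hs hn ((h.2.2 s hs hn).2 he)

theorem typeInvariant_sameType (y : BForest) :
    TypeInvariant d q k n comm (fun x => SameType d q k n comm x y) :=
  fun _ _ _ _ h hx => h.symm.trans hx

theorem typeInvariant_eq_nil (hn : 0 < n) : TypeInvariant d q k n comm (fun x => x = nil) :=
  fun _ _ _ hy h hx => h.2.2.eq_nil hn hy hx

/-- An upper bound with the type of `t` satisfies `Sub` again, so it can be joined with the next
member of the list. -/
theorem Dir.exists_above {t : BForest} (h : Dir k comm true (fun x => Sub k n comm x t)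
    (fun x => Sub k n comm x t) (fun x => SameType d q k n comm x t)) (ht : Val k t)
    (l : List BForest) (hl : ∀ x ∈ l, Val k x ∧ Sub k n comm x t) :
    ∃ z, Val k z ∧ SameType d q k n comm z t ∧ ∀ x ∈ l, Emb comm true x z := by
  induction l with
  | nil => exact ⟨t, ht, .refl t, by simp⟩
  | cons y l ih =>
    obtain ⟨z, hz, hzt, hzl⟩ := ih fun x hx => hl x (List.mem_cons_of_mem y hx)
    obtain ⟨hy, hyt⟩ := hl y List.mem_cons_self
    obtain ⟨w, hw, hwt, h1, h2⟩ := h z y hz hy (fun s hs hn he => (hzt.2.2 s hs hn).1 he) hyt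
    exact ⟨w, hw, hwt, by simpa [h2] using fun x hx => (hzl x hx).trans h1⟩

theorem exists_list_of_forall_mem {P : BForest → BForest → Prop} (l : List BForest)
    (h : ∀ x ∈ l, ∃ y, P x y) : ∃ l' : List BForest, (∀ y ∈ l', ∃ x ∈ l, P x y) ∧
    ∀ x ∈ l, ∃ y ∈ l', P x y := by
  induction l with
  | nil => exact ⟨[], by simp, by simp⟩
  | cons a l ih =>
    obtain ⟨l', h1, h2⟩ := ih fun x hx => h x (List.mem_cons_of_mem a hx)
    obtain ⟨b, hb⟩ := h a List.mem_cons_self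
    refine ⟨b :: l', fun y hy => ?_, fun x hx => ?_⟩
    · rcases List.mem_cons.1 hy with rfl | hy
      · exact ⟨a, List.mem_cons_self, hb⟩
      · obtain ⟨x, hx, hxy⟩ := h1 y hy
        exact ⟨x, List.mem_cons_of_mem a hx, hxy⟩
    · rcases List.mem_cons.1 hx with rfl | hx
      · exact ⟨b, List.mem_cons_self, hb⟩
      · obtain ⟨y, hy, hxy⟩ := h2 x hx
        exact ⟨y, List.mem_cons_of_mem b hy, hxy⟩

/-- In an increasing sequence, the pieces of the members of the sequence are determined by the
small pieces of a member whose type occurs infinitely often. -/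
theorem exists_limit (hB : ∀ x, run d q x ≤ B) (comm : Bool) (F : ℕ → BForest)
    (hmono : ∀ i j, i ≤ j → Emb false true (F i) (F j)) :
    ∃ n₀, ∀ n, n₀ ≤ n → ∃ i₀, (∀ i, ∃ j, i ≤ j ∧ SameType d q k n comm (F j) (F i₀)) ∧
      ∀ x, Val k x → (Sub k n comm x (F i₀) ↔ ∃ i, Emb comm true x (F i)) := by
  -- Every forest outside the downward closure of the sequence has a piece outside it with at most
  -- `n₀` nodes, so pieces of this size decide membership.
  obtain ⟨n₀, hn₀⟩ := exists_size_bound (k := k) {x | Val k x ∧ ¬ ∃ i, Emb comm true x (F i)}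
    fun x hx => hx.1
  refine ⟨n₀, fun n hn => ?_⟩
  let θ : ℕ → Set.range fun x => (run d q x, Single x, downType k n comm true x) :=
    fun i => ⟨_, F i, rfl⟩
  have := (finite_sameType (k := k) (n := n) (comm := comm) hB).to_subtype
  -- By the pigeonhole principle some type occurs infinitely often.
  obtain ⟨τ, hτ⟩ := Finite.exists_infinite_fiber θ
  have hτ : (θ ⁻¹' {τ}).Infinite := Set.infinite_coe_iff.1 hτ
  obtain ⟨i₀, hi₀⟩ := hτ.nonempty
  have htype : ∀ i, ∃ j, i ≤ j ∧ SameType d q k n comm (F j) (F i₀) := by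
    intro i
    obtain ⟨j, hj, hij⟩ := hτ.exists_gt i
    have h := congrArg Subtype.val (hj.trans hi₀.symm : θ j = θ i₀)
    simp only [θ, Prod.mk.injEq, eq_iff_iff] at h
    exact ⟨j, hij.le, h.1, h.2.1, sameDown_of_downType_eq h.2.2⟩
  refine ⟨i₀, htype, fun x hx => ⟨fun h => ?_, ?_⟩⟩
  · by_contra hno
    obtain ⟨z, hz, hzn, hzx⟩ := hn₀ x ⟨hx, hno⟩
    exact hz.2 ⟨i₀, h z hz.1 (hzn.trans hn) hzx.of_cca⟩
  · rintro ⟨i, hi⟩ s hs hsn he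
    obtain ⟨j, hij, hj⟩ := htype i
    exact (hj.2.2 s hs hsn).1 (he.trans (hi.trans (hmono i j hij).of_cca))

end BForest

open BForest

variable {d : ℕ → ℕ → ℕ → ℕ} {q k B : ℕ} {comm cca : Bool} {acc : ℕ → Prop}

theorem exists_separating_sequences (h : ¬ Testable k comm cca fun t => acc (run d q t)) :
    ∃ F F' : ℕ → BForest, ∀ i, Val k (F i) ∧ Val k (F' i) ∧ Single (F i) ∧ Single (F' i) ∧
      acc (run d q (F i)) ∧ ¬ acc (run d q (F' i)) ∧
      ∀ s, Val k s → size s ≤ i → (PieceRel comm cca s (F i) ↔ PieceRel comm cca s (F' i)) := by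
  have : ∀ i, ∃ t t', Val k t ∧ Val k t' ∧ Single t ∧ Single t' ∧
      acc (run d q t) ∧ ¬ acc (run d q t') ∧
      ∀ s, Val k s → size s ≤ i → (PieceRel comm cca s t ↔ PieceRel comm cca s t') := by
    intro i
    by_contra hno
    refine h ⟨i, fun t t' ht ht' hs hs' hp => ⟨fun ha => ?_, fun ha => ?_⟩⟩
    · by_contra ha'
      exact hno ⟨t, t', ht, ht', hs, hs', ha, ha', hp⟩
    · by_contra ha'
      exact hno ⟨t', t, ht', ht, hs', hs, ha, ha', fun s h1 h2 => (hp s h1 h2).symm⟩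
  choose F F' h using this
  exact ⟨F, F', h⟩

/-- Testability fails precisely if there are two trees, one of them accepted, such that the sets
of forests without small pieces outside these trees are directed and cofinal in each other. -/
theorem not_testable_iff (hB : ∀ x, run d q x ≤ B) :
    ¬ Testable k comm cca (fun t => acc (run d q t)) ↔ ∃ n t₀ t₁, 0 < n ∧
      (Val k t₀ ∧ Single t₀ ∧ acc (run d q t₀)) ∧ (Val k t₁ ∧ Single t₁ ∧ ¬ acc (run d q t₁)) ∧
      Dir k comm true (fun x => Sub k n comm x t₀) (fun x => Sub k n comm x t₀)
        (fun x => SameType d q k n comm x t₀) ∧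
      Dir k comm true (fun x => Sub k n comm x t₁) (fun x => Sub k n comm x t₁)
        (fun x => SameType d q k n comm x t₁) ∧
      -- Cofinality is written as `Dir` with `nil` as the second forest, so that the same
      -- certificates serve for it.
      Dir k false cca (fun x => Sub k n comm x t₀) (fun x => x = nil)
        (fun x => Sub k n comm x t₁) ∧
      Dir k false cca (fun x => Sub k n comm x t₁) (fun x => x = nil)
        (fun x => Sub k n comm x t₀) := by
  constructor
  · intro h
    obtain ⟨f, f', hf⟩ := exists_separating_sequences h
    -- A common subsequence along which both sequences increase. Since its indices satisfy `hle`,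
    -- agreement on pieces of size up to `i` survives.
    obtain ⟨g, hg⟩ := exists_emb_subseq f fun i => (hf i).1
    obtain ⟨g', hg'⟩ := exists_emb_subseq (fun i => f' (g i)) fun i => (hf _).2.1
    have hle : ∀ i, i ≤ g (g' i) := fun i =>
      (g'.strictMono.le_apply).trans g.strictMono.le_apply
    obtain ⟨n₀, hn₀⟩ := exists_limit (k := k) hB comm (fun i => f (g (g' i)))
      fun i j hij => hg _ _ (g'.monotone hij)
    obtain ⟨n₁, hn₁⟩ := exists_limit (k := k) hB comm (fun i => f' (g (g' i))) hg'
    obtain ⟨i₀, h1, h2⟩ := hn₀ (n₀ + n₁ + 1) (by omega)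
    obtain ⟨i₁, h3, h4⟩ := hn₁ (n₀ + n₁ + 1) (by omega)
    have dir : ∀ (F : ℕ → BForest) (i₀ : ℕ), (∀ i, Val k (F i)) →
        (∀ i j, i ≤ j → Emb false true (F i) (F j)) →
        (∀ i, ∃ j, i ≤ j ∧ SameType d q k (n₀ + n₁ + 1) comm (F j) (F i₀)) →
        (∀ x, Val k x → (Sub k (n₀ + n₁ + 1) comm x (F i₀) ↔ ∃ i, Emb comm true x (F i))) →
        Dir k comm true (fun x => Sub k (n₀ + n₁ + 1) comm x (F i₀))
          (fun x => Sub k (n₀ + n₁ + 1) comm x (F i₀))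
          (fun x => SameType d q k (n₀ + n₁ + 1) comm x (F i₀)) := by
      intro F i₀ hF hmono h1 h2 x y hx hy hIx hIy
      obtain ⟨i, hi⟩ := (h2 x hx).1 hIx
      obtain ⟨i', hi'⟩ := (h2 y hy).1 hIy
      obtain ⟨j, hj, hjt⟩ := h1 (max i i')
      exact ⟨F j, hF j, hjt, hi.trans (hmono i j (by omega)).of_cca,
        hi'.trans (hmono i' j (by omega)).of_cca⟩
    refine ⟨n₀ + n₁ + 1, f (g (g' i₀)), f' (g (g' i₁)), Nat.succ_pos _,
      ⟨(hf _).1, (hf _).2.2.1, (hf _).2.2.2.2.1⟩, ⟨(hf _).2.1, (hf _).2.2.2.1, (hf _).2.2.2.2.2.1⟩,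
      dir (fun i => f (g (g' i))) _ (fun i => (hf _).1) (fun i j hij => hg _ _ (g'.monotone hij)) h1 h2,
      dir (fun i => f' (g (g' i))) _ (fun i => (hf _).2.1) hg' h3 h4, ?_, ?_⟩
    -- `x` is a piece of an accepted tree whose index is at least `size x`, hence of the rejected
    -- tree with this index. The intermediate forest `u` of that `PieceRel` lies in the other ideal.
    · rintro x y hx - hIx rfl
      obtain ⟨i, hi⟩ := (h2 x hx).1 hIx
      have hp : PieceRel comm cca x (f (g (g' (max i (size x))))) := ⟨x, .refl x,
        hi.trans (hg _ _ (g'.monotone (le_max_left i (size x)))).of_cca⟩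
      obtain ⟨u, hu1, hu2⟩ := ((hf _).2.2.2.2.2.2 x hx
        ((le_max_right i (size x)).trans (hle _))).1 hp
      have hu := hu2.val (hf _).2.1
      exact ⟨u, hu, (h4 u hu).2 ⟨_, hu2⟩, hu1, .nil_left u⟩
    · rintro x y hx - hIx rfl
      obtain ⟨i, hi⟩ := (h4 x hx).1 hIx
      have hp : PieceRel comm cca x (f' (g (g' (max i (size x))))) := ⟨x, .refl x,
        hi.trans (hg' _ _ (le_max_left i (size x))).of_cca⟩
      obtain ⟨u, hu1, hu2⟩ := ((hf _).2.2.2.2.2.2 x hx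
        ((le_max_right i (size x)).trans (hle _))).2 hp
      have hu := hu2.val (hf _).1
      exact ⟨u, hu, (h2 u hu).2 ⟨_, hu2⟩, hu1, .nil_left u⟩
  · rintro ⟨n, t₀, t₁, hn, ⟨hv₀, hs₀, ha₀⟩, ⟨hv₁, hs₁, ha₁⟩, hD₀, hD₁, hE₀, hE₁⟩ ⟨N, hN⟩
    classical
    -- Cofinality is used only for forests with at most `2 * N` nodes, through which all pieces with
    -- at most `N` nodes factor.
    have lists : ∀ t t' : BForest, Dir k false cca (fun x => Sub k n comm x t) (fun x => x = nil)
        (fun x => Sub k n comm x t') → ∃ l : List BForest, (∀ y ∈ l, Val k y ∧ Sub k n comm y t') ∧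
        ∀ x, Val k x → size x ≤ 2 * N → Sub k n comm x t → ∃ y ∈ l, Emb false cca x y := by
      intro t t' hE
      obtain ⟨l, h1, h2⟩ := exists_list_of_forall_mem
        (P := fun x y => Val k y ∧ Sub k n comm y t' ∧ Emb false cca x y)
        ((forestsUpTo k (2 * N)).filter fun x => Sub k n comm x t) (by
          intro x hx
          rw [List.mem_filter, mem_forestsUpTo, decide_eq_true_eq] at hx
          obtain ⟨z, h1, h2, h3, -⟩ := hE x nil hx.1.1 trivial hx.2 rfl
          exact ⟨z, h1, h2, h3⟩)
      refine ⟨l, fun y hy => ?_, fun x hx hxN hxt => ?_⟩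
      · obtain ⟨_, _, h3, h4, _⟩ := h1 y hy
        exact ⟨h3, h4⟩
      · obtain ⟨y, hy, _, _, h3⟩ := h2 x (List.mem_filter.2 ⟨mem_forestsUpTo.2 ⟨hx, hxN⟩,
          decide_eq_true hxt⟩)
        exact ⟨y, hy, h3⟩
    obtain ⟨l₁, hl₁, hl₁'⟩ := lists t₀ t₁ hE₀
    obtain ⟨l₀, hl₀, hl₀'⟩ := lists t₁ t₀ hE₁
    -- By their types, `z₀` is an accepted tree and `z₁` a rejected one. Each lies above the forests
    -- needed to cover the small pieces of the other, so they agree on pieces with at most `N`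
    -- nodes.
    obtain ⟨z₀, hz₀, hzt₀, hzl₀⟩ := hD₀.exists_above hv₀ l₀ hl₀
    obtain ⟨z₁, hz₁, hzt₁, hzl₁⟩ := hD₁.exists_above hv₁ l₁ hl₁
    have main : ∀ (z z' t t' : BForest) (l : List BForest), Val k z → SameType d q k n comm z t →
        (∀ x, Val k x → size x ≤ 2 * N → Sub k n comm x t → ∃ y ∈ l, Emb false cca x y) →
        (∀ x ∈ l, Emb comm true x z') → ∀ s, size s ≤ N → PieceRel comm cca s z →
        PieceRel comm cca s z' := by
      intro z z' t t' l hz hzt hl hzl s hs hp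
      obtain ⟨u, hu, h1, h2⟩ := hp.exists_size_le
      obtain ⟨y, hy, huy⟩ := hl u (h2.val hz) (by omega) fun r hr hrn he =>
        (hzt.2.2 r hr hrn).1 (he.trans h2)
      exact ⟨y, h1.trans huy, hzl y hy⟩
    have := hN z₀ z₁ hz₀ hz₁ (hzt₀.2.1.2 hs₀) (hzt₁.2.1.2 hs₁) fun s _ hs =>
      ⟨main z₀ z₁ t₀ t₁ l₁ hz₀ hzt₀ hl₁' hzl₁ s hs, main z₁ z₀ t₁ t₀ l₀ hz₁ hzt₁ hl₀' hzl₀ s hs⟩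
    dsimp only at this
    rw [hzt₀.1, hzt₁.1] at this
    exact ha₁ (this.1 ha₀)

/-- Certificate that testability fails; the numbers `e i` are the parameters of the four
certificates of directedness. -/
structure NegCert (d : ℕ → ℕ → ℕ → ℕ) (q k : ℕ) (comm cca : Bool) (acc : ℕ → Prop) (n : ℕ)
    (t₀ t₁ : BForest) (e₀ e₁ e₂ e₃ : ℕ × ℕ × ℕ) : Prop where
  pos : 0 < n
  left : Val k t₀ ∧ Single t₀ ∧ acc (run d q t₀)
  right : Val k t₁ ∧ Single t₁ ∧ ¬ acc (run d q t₁)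
  dir_left : DirCert d q k n comm comm true (fun x => Sub k n comm x t₀)
    (fun x => Sub k n comm x t₀) (fun x => SameType d q k n comm x t₀) e₀.1 e₀.2.1 e₀.2.2
  dir_right : DirCert d q k n comm comm true (fun x => Sub k n comm x t₁)
    (fun x => Sub k n comm x t₁) (fun x => SameType d q k n comm x t₁) e₁.1 e₁.2.1 e₁.2.2
  cofinal_left : DirCert d q k n comm false cca (fun x => Sub k n comm x t₀) (fun x => x = nil)
    (fun x => Sub k n comm x t₁) e₂.1 e₂.2.1 e₂.2.2
  cofinal_right : DirCert d q k n comm false cca (fun x => Sub k n comm x t₁) (fun x => x = nil)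
    (fun x => Sub k n comm x t₀) e₃.1 e₃.2.1 e₃.2.2

theorem not_testable_iff_exists_negCert (hB : ∀ x, run d q x ≤ B) :
    ¬ Testable k comm cca (fun t => acc (run d q t)) ↔ ∃ n t₀ t₁ e₀ e₁ e₂ e₃,
      NegCert d q k comm cca acc n t₀ t₁ e₀ e₁ e₂ e₃ := by
  rw [not_testable_iff hB]
  constructor
  · rintro ⟨n, t₀, t₁, hn, h₀, h₁, hD₀, hD₁, hE₀, hE₁⟩
    obtain ⟨m₀, N₀, M₀, c₀⟩ := exists_dirCert (n := n) (comm := comm) hB hD₀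
    obtain ⟨m₁, N₁, M₁, c₁⟩ := exists_dirCert (n := n) (comm := comm) hB hD₁
    obtain ⟨m₂, N₂, M₂, c₂⟩ := exists_dirCert (n := n) (comm := comm) hB hE₀
    obtain ⟨m₃, N₃, M₃, c₃⟩ := exists_dirCert (n := n) (comm := comm) hB hE₁
    exact ⟨n, t₀, t₁, (m₀, N₀, M₀), (m₁, N₁, M₁), (m₂, N₂, M₂), (m₃, N₃, M₃), hn, h₀, h₁,
      c₀, c₁, c₂, c₃⟩
  · rintro ⟨n, t₀, t₁, e₀, e₁, e₂, e₃, h⟩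
    exact ⟨n, t₀, t₁, h.pos, h.left, h.right,
      h.dir_left.dir h.pos (typeInvariant_sub _) (typeInvariant_sub _) (typeInvariant_sameType _),
      h.dir_right.dir h.pos (typeInvariant_sub _) (typeInvariant_sub _) (typeInvariant_sameType _),
      h.cofinal_left.dir h.pos (typeInvariant_sub _) (typeInvariant_eq_nil h.pos)
        (typeInvariant_sub _),
      h.cofinal_right.dir h.pos (typeInvariant_sub _) (typeInvariant_eq_nil h.pos)
        (typeInvariant_sub _)⟩

end PiecewiseTestable

-- Closure properties of primitive recursive functions and predicates.

attribute [fun_prop] Primrec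

namespace PiecewiseTestable

section Primrec

open Encodable

variable {α β γ σ : Type*} [Primcodable α] [Primcodable β] [Primcodable γ] [Primcodable σ]

@[fun_prop]
theorem primrec_id : Primrec fun a : α => a := Primrec.id

@[fun_prop]
theorem primrec_const (b : β) : Primrec fun _ : α => b := Primrec.const b

@[fun_prop]
theorem primrec_comp {f : β → γ} {g : α → β} (hf : Primrec f) (hg : Primrec g) :
    Primrec fun a => f (g a) := hf.comp hg

@[fun_prop]
theorem primrec_pair {f : α → β} {g : α → γ} (hf : Primrec f) (hg : Primrec g) :
    Primrec fun a => (f a, g a) := hf.pair hg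

@[fun_prop]
theorem primrec_fst {f : α → β × γ} (hf : Primrec f) : Primrec fun a => (f a).1 :=
  Primrec.fst.comp hf

@[fun_prop]
theorem primrec_snd {f : α → β × γ} (hf : Primrec f) : Primrec fun a => (f a).2 :=
  Primrec.snd.comp hf

@[fun_prop]
theorem primrec_add {f g : α → ℕ} (hf : Primrec f) (hg : Primrec g) :
    Primrec fun a => f a + g a := Primrec.nat_add.comp hf hg

@[fun_prop]
theorem primrec_mul {f g : α → ℕ} (hf : Primrec f) (hg : Primrec g) :
    Primrec fun a => f a * g a := Primrec.nat_mul.comp hf hg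

@[fun_prop]
theorem primrec_natPair {f g : α → ℕ} (hf : Primrec f) (hg : Primrec g) :
    Primrec fun a => Nat.pair (f a) (g a) := Primrec₂.natPair.comp hf hg

@[fun_prop]
theorem primrec_unpair {f : α → ℕ} (hf : Primrec f) : Primrec fun a => Nat.unpair (f a) :=
  Primrec.unpair.comp hf

@[fun_prop]
theorem primrec_append {f g : α → List β} (hf : Primrec f) (hg : Primrec g) :
    Primrec fun a => f a ++ g a := Primrec.list_append.comp hf hg

@[fun_prop]
theorem primrec_cons {f : α → β} {g : α → List β} (hf : Primrec f) (hg : Primrec g) :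
    Primrec fun a => f a :: g a := Primrec.list_cons.comp hf hg

@[fun_prop]
theorem primrec_some {f : α → β} (hf : Primrec f) : Primrec fun a => some (f a) :=
  Primrec.option_some.comp hf

@[fun_prop]
theorem primrec_range {f : α → ℕ} (hf : Primrec f) : Primrec fun a => List.range (f a) :=
  Primrec.list_range.comp hf

@[fun_prop]
theorem primrec_length {f : α → List β} (hf : Primrec f) : Primrec fun a => (f a).length :=
  Primrec.list_length.comp hf

@[fun_prop]
theorem primrec_getD {f : α → List β} {g : α → ℕ} (d : β) (hf : Primrec f) (hg : Primrec g) :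
    Primrec fun a => (f a).getD (g a) d := (Primrec.list_getD d).comp hf hg

theorem primrec_map {f : α → List β} {g : α → β → γ} (hf : Primrec f)
    (hg : Primrec fun p : α × β => g p.1 p.2) : Primrec fun a => (f a).map (g a) :=
  Primrec.list_map hf hg

theorem primrec_flatMap {f : α → List β} {g : α → β → List γ} (hf : Primrec f)
    (hg : Primrec fun p : α × β => g p.1 p.2) : Primrec fun a => (f a).flatMap (g a) :=
  Primrec.list_flatMap hf hg

theorem primrecPred_eq {f g : α → β} (hf : Primrec f) (hg : Primrec g) :
    PrimrecPred fun a => f a = g a := Primrec.eq.comp hf hg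

theorem primrecPred_le {f g : α → ℕ} (hf : Primrec f) (hg : Primrec g) :
    PrimrecPred fun a => f a ≤ g a := Primrec.nat_le.comp hf hg

theorem primrecPred_lt {f g : α → ℕ} (hf : Primrec f) (hg : Primrec g) :
    PrimrecPred fun a => f a < g a := Primrec.nat_lt.comp hf hg

theorem primrecPred_imp {p q : α → Prop} (hp : PrimrecPred p) (hq : PrimrecPred q) :
    PrimrecPred fun a => p a → q a :=
  (hp.not.or hq).of_eq fun _ => imp_iff_not_or.symm

theorem primrecPred_iff {p q : α → Prop} (hp : PrimrecPred p) (hq : PrimrecPred q) :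
    PrimrecPred fun a => p a ↔ q a :=
  ((primrecPred_imp hp hq).and (primrecPred_imp hq hp)).of_eq fun _ => iff_def.symm

theorem primrecPred_exists_mem {l : α → List β} {p : α → β → Prop} (hl : Primrec l)
    (hp : PrimrecPred fun q : α × β => p q.1 q.2) : PrimrecPred fun a => ∃ b ∈ l a, p a b :=
  (PrimrecRel.exists_mem_list (R := fun b a => p a b)
    (PrimrecPred.comp hp (Primrec.snd.pair Primrec.fst))).comp hl Primrec.id

theorem primrecPred_forall_mem {l : α → List β} {p : α → β → Prop} (hl : Primrec l)
    (hp : PrimrecPred fun q : α × β => p q.1 q.2) : PrimrecPred fun a => ∀ b ∈ l a, p a b :=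
  (PrimrecRel.forall_mem_list (R := fun b a => p a b)
    (PrimrecPred.comp hp (Primrec.snd.pair Primrec.fst))).comp hl Primrec.id

theorem primrecPred_forall_lt {f : α → ℕ} {p : α → ℕ → Prop} (hf : Primrec f)
    (hp : PrimrecPred fun q : α × ℕ => p q.1 q.2) : PrimrecPred fun a => ∀ b < f a, p a b :=
  (primrecPred_forall_mem (Primrec.list_range.comp hf) hp).of_eq fun _ => by simp

theorem primrecPred_mem {f : α → β} {l : α → List β} (hf : Primrec f) (hl : Primrec l) :
    PrimrecPred fun a => f a ∈ l a :=
  (primrecPred_exists_mem hl (p := fun a b => b = f a)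
    (primrecPred_eq Primrec.snd (hf.comp Primrec.fst))).of_eq fun _ => by simp

theorem primrec_filter {l : α → List β} {p : α → β → Prop} [∀ a, DecidablePred (p a)]
    (hl : Primrec l) (hp : PrimrecPred fun q : α × β => p q.1 q.2) :
    Primrec fun a => (l a).filter fun b => p a b :=
  (PrimrecRel.listFilter (R := fun b a => p a b)
    (PrimrecPred.comp hp (Primrec.snd.pair Primrec.fst))).comp hl Primrec.id

/-- Unbounded search through the codes of possible witnesses. -/
theorem rePred_exists {p : α → β → Prop} (hp : PrimrecPred fun q : α × β => p q.1 q.2) :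
    REPred fun a => ∃ b, p a b := by
  classical
  have h : Primrec₂ fun (a : α) (n : ℕ) => (decode n : Option β).bind (Option.guard fun b => p a b) :=
    Primrec.option_bind (Primrec.decode.comp Primrec.snd) (Primrec.option_guard
      (p := fun (q : (α × ℕ) × β) b => p q.1.1 b)
      (PrimrecPred.comp hp (by fun_prop : Primrec fun r : ((α × ℕ) × β) × β => (r.1.1.1, r.2)))
      Primrec.snd)
  refine (Partrec.rfindOpt h.to_comp).dom_re.of_eq fun a => ?_
  rw [Nat.rfindOpt_dom]
  constructor
  · rintro ⟨n, b, hb⟩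
    obtain ⟨c, _, hc⟩ := Option.mem_bind_iff.1 hb
    simp only [Option.mem_def, Option.guard_eq_some_iff, decide_eq_true_eq] at hc
    exact ⟨c, hc.2⟩
  · rintro ⟨b, hb⟩
    exact ⟨encode b, b, by simp [hb]⟩

end Primrec

-- Primitive recursion on forests.

namespace BForest

/-- Numbering of the forests. -/
def toNat : BForest → ℕ
  | nil => 0
  | node a c s => Nat.pair (Nat.pair a (toNat c)) (toNat s) + 1

/-- Inverse of `toNat`. -/
def ofNat : ℕ → BForest
  | 0 => nil
  | n + 1 => node n.unpair.1.unpair.1 (ofNat n.unpair.1.unpair.2) (ofNat n.unpair.2)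
decreasing_by
  · exact Nat.lt_succ_of_le ((Nat.unpair_right_le _).trans (Nat.unpair_left_le _))
  · exact Nat.lt_succ_of_le (Nat.unpair_right_le _)

theorem ofNat_toNat (x : BForest) : ofNat (toNat x) = x := by
  induction x with
  | nil => rw [toNat, ofNat]
  | node a c s ihc ihs => rw [toNat, ofNat]; simp [ihc, ihs]

theorem toNat_ofNat (n : ℕ) : toNat (ofNat n) = n := by
  induction n using Nat.strong_induction_on with
  | _ n ih =>
    cases n with
    | zero => rw [ofNat, toNat]
    | succ n =>
      rw [ofNat, toNat, ih _ (Nat.lt_succ_of_le ((Nat.unpair_right_le _).trans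
        (Nat.unpair_left_le _))), ih _ (Nat.lt_succ_of_le (Nat.unpair_right_le _))]
      simp

/-- The numbering of the forests as a bijection. -/
def equivNat : BForest ≃ ℕ := ⟨toNat, ofNat, ofNat_toNat, toNat_ofNat⟩

instance : Primcodable BForest := Primcodable.ofEquiv ℕ equivNat

variable {α β : Type*} [Primcodable α] [Primcodable β]

@[fun_prop]
theorem primrec_toNat {f : α → BForest} (hf : Primrec f) : Primrec fun a => toNat (f a) :=
  (Primrec.of_equiv (e := equivNat)).comp hf

@[fun_prop]
theorem primrec_ofNat {f : α → ℕ} (hf : Primrec f) : Primrec fun a => ofNat (f a) :=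
  (Primrec.of_equiv_symm (e := equivNat)).comp hf

@[fun_prop]
theorem primrec_node {f : α → ℕ} {g h : α → BForest} (hf : Primrec f) (hg : Primrec g)
    (hh : Primrec h) : Primrec fun a => node (f a) (g a) (h a) :=
  (primrec_ofNat (f := fun a => toNat (node (f a) (g a) (h a)))
    (by simp only [toNat]; fun_prop)).of_eq fun _ => ofNat_toNat _

/-- Functions defined by structural recursion on forests are primitive recursive. -/
theorem primrec_rec {f : α → BForest → β} {g : α → β}
    {h : α → ℕ → BForest → BForest → β → β → β} (hg : Primrec g)
    (hh : Primrec fun p : α × ℕ × BForest × BForest × β × β =>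
      h p.1 p.2.1 p.2.2.1 p.2.2.2.1 p.2.2.2.2.1 p.2.2.2.2.2)
    (hnil : ∀ p, f p nil = g p)
    (hnode : ∀ p a c s, f p (node a c s) = h p a c s (f p c) (f p s)) :
    Primrec fun p : α × BForest => f p.1 p.2 := by
  let F : α × List β → ℕ → Option β := fun p n =>
    (p.2[n.unpair.1.unpair.2]?).bind fun r => (p.2[n.unpair.2]?).map fun r' =>
      h p.1 n.unpair.1.unpair.1 (ofNat n.unpair.1.unpair.2) (ofNat n.unpair.2) r r'
  have hF : Primrec₂ F := by
    refine Primrec.option_bind (Primrec.list_getElem?.comp (by fun_prop) (by fun_prop)) ?_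
    refine Primrec.option_map (Primrec.list_getElem?.comp (by fun_prop) (by fun_prop)) ?_
    exact hh.comp (by fun_prop : Primrec fun q : (((α × List β) × ℕ) × β) × β =>
      (q.1.1.1.1, q.1.1.2.unpair.1.unpair.1, ofNat q.1.1.2.unpair.1.unpair.2,
        ofNat q.1.1.2.unpair.2, q.1.2, q.2))
  -- Course-of-values recursion on codes: the child and sibling forests of a node have smaller codes
  -- than the node.
  have key : Primrec₂ fun p n => f p (ofNat n) := by
    refine Primrec.nat_strong_rec _ (g := fun p l => Nat.casesOn l.length (some (g p)) (F (p, l)))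
      (Primrec.nat_casesOn (by fun_prop) (by fun_prop)
        (hF.comp (by fun_prop : Primrec fun q : (α × List β) × ℕ => q.1)
          (by fun_prop : Primrec fun q : (α × List β) × ℕ => q.2)).to₂) fun p n => ?_
    cases n with
    | zero => simp [ofNat, hnil]
    | succ n =>
      have h1 : n.unpair.1.unpair.2 < n + 1 :=
        Nat.lt_succ_of_le ((Nat.unpair_right_le _).trans (Nat.unpair_left_le _))
      have h2 : n.unpair.2 < n + 1 := Nat.lt_succ_of_le (Nat.unpair_right_le _)
      simp only [List.length_map, List.length_range, F, List.getElem?_map,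
        List.getElem?_range h1, List.getElem?_range h2, Option.map_some, Option.bind_some]
      rw [ofNat, hnode]
  exact (key.comp Primrec.fst (primrec_toNat Primrec.snd)).of_eq fun p => by rw [ofNat_toNat]

@[fun_prop]
theorem primrec_size {f : α → BForest} (hf : Primrec f) : Primrec fun a => size (f a) :=
  (primrec_rec (f := fun _ : Unit => size) (g := fun _ => 0) (h := fun _ _ _ _ r r' => r + r' + 1)
    (by fun_prop) (by fun_prop) (fun _ => rfl) (fun _ _ _ _ => rfl)).comp
    (by fun_prop : Primrec fun a => ((), f a))

@[fun_prop]
theorem primrec_label {f : α → BForest} (hf : Primrec f) : Primrec fun a => label (f a) :=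
  (primrec_rec (f := fun _ : Unit => label) (g := fun _ => 0) (h := fun _ a _ _ _ _ => a)
    (by fun_prop) (by fun_prop) (fun _ => rfl) (fun _ _ _ _ => rfl)).comp
    (by fun_prop : Primrec fun a => ((), f a))

@[fun_prop]
theorem primrec_child {f : α → BForest} (hf : Primrec f) : Primrec fun a => child (f a) :=
  (primrec_rec (f := fun _ : Unit => child) (g := fun _ => nil) (h := fun _ _ c _ _ _ => c)
    (by fun_prop) (by fun_prop) (fun _ => rfl) (fun _ _ _ _ => rfl)).comp
    (by fun_prop : Primrec fun a => ((), f a))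

@[fun_prop]
theorem primrec_splits (comm : Bool) {f : α → BForest} (hf : Primrec f) :
    Primrec fun a => splits comm (f a) := by
  refine (primrec_rec (f := fun _ : Unit => splits comm) (g := fun _ => [(nil, nil)])
    (h := fun _ a c s _ r => (if comm then r.map fun p => (p.1, node a c p.2)
      else [(nil, node a c s)]) ++ r.map fun p => (node a c p.1, p.2))
    (by fun_prop) ?_ (fun _ => rfl) (fun _ _ _ _ => rfl)).comp
    (by fun_prop : Primrec fun a => ((), f a))
  refine primrec_append ?_ (primrec_map (by fun_prop) (by fun_prop))
  cases comm
  · simp only [Bool.false_eq_true, if_false]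
    fun_prop
  · exact primrec_map (by fun_prop) (by fun_prop)

@[fun_prop]
theorem primrec_forestsUpTo {f g : α → ℕ} (hf : Primrec f) (hg : Primrec g) :
    Primrec fun a => forestsUpTo (f a) (g a) := by
  refine (Primrec.nat_rec' hg (g := fun _ => [nil]) (h := fun a p => nil ::
    (List.range (f a)).flatMap fun b => p.2.flatMap fun c =>
      (p.2.filter fun s => size c + size s ≤ p.1).map fun s => node b c s) (by fun_prop) ?_).of_eq
    fun a => ?_
  · refine primrec_cons (by fun_prop) (primrec_flatMap (by fun_prop) (primrec_flatMap (by fun_prop)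
      (primrec_map (primrec_filter (by fun_prop) (primrecPred_le (by fun_prop) (by fun_prop)))
        (by fun_prop))))
  · induction g a with
    | zero => rfl
    | succ n ih => simp only [forestsUpTo, ih]

theorem primrecPred_single {f : α → BForest} (hf : Primrec f) :
    PrimrecPred fun a => Single (f a) := by
  refine (primrecPred_eq hf (g := fun a => node (label (f a)) (child (f a)) nil)
    (by fun_prop)).of_eq fun a => ⟨fun h => ?_, fun h => h.eq_node⟩
  rw [h]
  rfl

theorem primrecPred_small {f : α → BForest} (hf : Primrec f) :
    PrimrecPred fun a => Small (f a) :=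
  ((primrecPred_eq hf (primrec_const nil)).or (primrecPred_single hf)).of_eq fun _ =>
    small_iff.symm

theorem primrecPred_val {f : α → BForest} {k : α → ℕ} (hk : Primrec k) (hf : Primrec f) :
    PrimrecPred fun a => Val (k a) (f a) :=
  (primrecPred_mem hf (primrec_forestsUpTo hk (primrec_size hf))).of_eq fun _ => by
    simp [mem_forestsUpTo]

theorem size_le_toNat (x : BForest) : size x ≤ toNat x := by
  induction x with
  | nil => rfl
  | node a c s ihc ihs =>
    have h1 := Nat.add_le_pair (Nat.pair a (toNat c)) (toNat s)
    have h2 := Nat.add_le_pair a (toNat c)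
    simp only [size, toNat]
    omega

theorem Val.mono {k l : ℕ} {x : BForest} (h : Val k x) (hkl : k ≤ l) : Val l x := by
  induction x with
  | nil => trivial
  | node a c s ihc ihs => exact ⟨h.1.trans_le hkl, ihc h.2.1, ihs h.2.2⟩

theorem val_toNat (x : BForest) : Val (toNat x + 1) x := by
  induction x with
  | nil => trivial
  | node a c s ihc ihs =>
    have h1 := Nat.add_le_pair (Nat.pair a (toNat c)) (toNat s)
    have h2 := Nat.add_le_pair a (toNat c)
    simp only [Val, toNat]
    exact ⟨by omega, ihc.mono (by omega), ihs.mono (by omega)⟩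

open Classical in
/-- The elements of `W` embedded into a forest, provided that `W` is closed under parts. -/
noncomputable def downList (comm cca : Bool) (W : List BForest) : BForest → List BForest
  | nil => W.filter fun x => x = nil
  | node a c s => W.filter fun x => ∃ p ∈ splits comm x, p.2 ∈ downList comm cca W s ∧
      (((cca = true → Small p.1) ∧ p.1 ∈ downList comm cca W c) ∨
        (Single p.1 ∧ label p.1 = a) ∧ child p.1 ∈ downList comm cca W c)

/-- The first argument of `Emb` varies in its recursion. Tabulating it over `forestsUpTo k N`, which
contains the parts of its members, leaves a recursion on `t` alone, as `primrec_rec` requires. -/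
theorem mem_downList {comm cca : Bool} {k N : ℕ} {x t : BForest} :
    x ∈ downList comm cca (forestsUpTo k N) t ↔ x ∈ forestsUpTo k N ∧ Emb comm cca x t := by
  induction t generalizing x with
  | nil => simp [downList, Emb]
  | node a c s ihc ihs =>
    simp only [downList, List.mem_filter, decide_eq_true_eq, ihc, ihs]
    refine and_congr_right fun hx => ?_
    rw [mem_forestsUpTo] at hx
    constructor
    · rintro ⟨⟨x₁, x₂⟩, hp, h2, h1⟩
      refine ⟨x₁, x₂, mem_splits.1 hp, h2.2, h1.imp (fun h => ⟨h.1, h.2.2⟩) ?_⟩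
      rintro ⟨⟨h3, rfl⟩, -, h4⟩
      exact ⟨child x₁, h3.eq_node, h4⟩
    · rintro ⟨x₁, x₂, hm, h2, h1⟩
      have hv := hm.val_iff.1 hx.1
      have hsz := hm.size_eq
      refine ⟨(x₁, x₂), mem_splits.2 hm, ⟨mem_forestsUpTo.2 ⟨hv.2, by dsimp only; omega⟩, h2⟩,
        h1.imp (fun h => ⟨h.1, mem_forestsUpTo.2 ⟨hv.1, by dsimp only; omega⟩, h.2⟩) ?_⟩
      rintro ⟨x', rfl, h⟩
      simp only [size] at hsz
      exact ⟨⟨rfl, rfl⟩, mem_forestsUpTo.2 ⟨hv.1.2.1, by simp only [child]; omega⟩, h⟩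

theorem primrec_downList (comm cca : Bool) :
    Primrec fun p : List BForest × BForest => downList comm cca p.1 p.2 := by
  classical
  refine primrec_rec (f := downList comm cca) (g := fun W => W.filter fun x => x = nil)
    (h := fun W a c s r r' => W.filter fun x => ∃ p ∈ splits comm x, p.2 ∈ r' ∧
      (((cca = true → Small p.1) ∧ p.1 ∈ r) ∨ (Single p.1 ∧ label p.1 = a) ∧ child p.1 ∈ r))
    (primrec_filter (by fun_prop) (primrecPred_eq (by fun_prop) (by fun_prop)))
    (primrec_filter (by fun_prop) (primrecPred_exists_mem (by fun_prop) ?_))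
    (fun _ => by simp only [downList]) (fun _ _ _ _ => by simp only [downList])
  exact (primrecPred_mem (by fun_prop) (by fun_prop)).and
    (((primrecPred_imp (primrecPred_eq (by fun_prop) (by fun_prop))
      (primrecPred_small (by fun_prop))).and (primrecPred_mem (by fun_prop) (by fun_prop))).or
    (((primrecPred_single (by fun_prop)).and (primrecPred_eq (by fun_prop) (by fun_prop))).and
      (primrecPred_mem (by fun_prop) (by fun_prop))))

theorem primrecPred_emb (comm cca : Bool) {f g : α → BForest} (hf : Primrec f) (hg : Primrec g) :
    PrimrecPred fun a => Emb comm cca (f a) (g a) := by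
  -- The code of `f a` bounds its size and its labels, so the table is large enough to contain `f
  -- a`.
  refine (primrecPred_mem hf ((primrec_downList comm cca).comp
    (by fun_prop : Primrec fun a => (forestsUpTo (toNat (f a) + 1) (toNat (f a)), g a)))).of_eq
    fun a => ?_
  rw [mem_downList, mem_forestsUpTo]
  exact and_iff_right ⟨val_toNat _, size_le_toNat _⟩

end BForest


-- The automaton of a presentation and the decision procedure.

open BForest

/-- Size of the alphabet. -/
def Presentation.alphabet (P : Presentation) : ℕ := P.2.2.2.2.2.1.length

/-- Value of the empty forest. -/
def Presentation.init (P : Presentation) : ℕ := P.2.1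

/-- Value of `a c + s`, given the values `x` of `c` and `y` of `s`. -/
def Presentation.step (P : Presentation) (a x y : ℕ) : ℕ :=
  (P.1.getD ((P.2.2.2.2.1.getD (P.2.2.2.2.2.1.getD a 0) []).getD x 0) []).getD y 0

/-- The accepting values. -/
def Presentation.Acc (P : Presentation) (x : ℕ) : Prop := P.2.2.2.2.2.2.getD x false = true

/-- Indices out of range give the default `0`, so the values are bounded for arbitrary lists, not
only for those that come from a forest algebra. The criteria by certificates therefore apply to
every input. -/
theorem Presentation.exists_run_le (P : Presentation) :
    ∃ B, ∀ x, run P.step P.init x ≤ B := by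
  have getD_le : ∀ (l : List ℕ) (i : ℕ), l.getD i 0 ≤ l.sum := fun l i => by
    by_cases h : i < l.length
    · rw [List.getD_eq_getElem _ _ h]
      exact List.le_sum_of_mem (List.getElem_mem h)
    · rw [List.getD_eq_default _ _ (by omega)]
      exact Nat.zero_le _
  have getD_le' : ∀ (l : List (List ℕ)) (i j : ℕ), (l.getD i []).getD j 0 ≤ (l.map List.sum).sum := by
    intro l i j
    by_cases h : i < l.length
    · rw [List.getD_eq_getElem _ _ h]
      exact (getD_le _ j).trans (List.le_sum_of_mem (List.mem_map.2 ⟨_, List.getElem_mem h, rfl⟩))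
    · rw [List.getD_eq_default l _ (by omega)]
      exact Nat.zero_le _
  refine ⟨P.init + (P.1.map List.sum).sum, fun x => ?_⟩
  cases x with
  | nil => exact Nat.le_add_right _ _
  | node a c s => exact (getD_le' _ _ _).trans (Nat.le_add_left _ _)

section Primrec

variable {α : Type*} [Primcodable α] {P : α → Presentation} {f g h k m n N M : α → ℕ}
  {x y : α → BForest} {I J K : α → BForest → Prop}

@[fun_prop]
theorem primrec_alphabet (hP : Primrec P) : Primrec fun a => (P a).alphabet := by
  unfold Presentation.alphabet
  fun_prop

@[fun_prop]
theorem primrec_init (hP : Primrec P) : Primrec fun a => (P a).init := by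
  unfold Presentation.init
  fun_prop

@[fun_prop]
theorem primrec_step (hP : Primrec P) (hf : Primrec f) (hg : Primrec g) (hh : Primrec h) :
    Primrec fun a => (P a).step (f a) (g a) (h a) := by
  unfold Presentation.step
  fun_prop

theorem primrecPred_acc (hP : Primrec P) (hf : Primrec f) :
    PrimrecPred fun a => (P a).Acc (f a) :=
  primrecPred_eq (by fun_prop) (by fun_prop)

@[fun_prop]
theorem primrec_run (hP : Primrec P) (hx : Primrec x) :
    Primrec fun a => run (P a).step (P a).init (x a) :=
  (primrec_rec (f := fun P : Presentation => run P.step P.init) (g := fun P => P.init)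
    (h := fun P a _ _ r r' => P.step a r r') (by fun_prop) (by fun_prop) (fun _ => rfl)
    (fun _ _ _ _ => rfl)).comp (by fun_prop : Primrec fun a => (P a, x a))

theorem primrecPred_sub (comm : Bool) (hk : Primrec k) (hn : Primrec n) (hx : Primrec x)
    (hy : Primrec y) : PrimrecPred fun a => BForest.Sub (k a) (n a) comm (x a) (y a) :=
  (primrecPred_forall_mem (l := fun a => forestsUpTo (k a) (n a))
    (p := fun a s => Emb comm true s (x a) → Emb comm true s (y a)) (by fun_prop)
    (primrecPred_imp (primrecPred_emb _ _ (by fun_prop) (by fun_prop))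
      (primrecPred_emb _ _ (by fun_prop) (by fun_prop)))).of_eq fun _ => by
    simp only [mem_forestsUpTo, and_imp, BForest.Sub]

theorem primrecPred_sameDown (comm cca : Bool) (hk : Primrec k) (hn : Primrec n)
    (hx : Primrec x) (hy : Primrec y) :
    PrimrecPred fun a => SameDown (k a) (n a) comm cca (x a) (y a) :=
  (primrecPred_forall_mem (l := fun a => forestsUpTo (k a) (n a))
    (p := fun a s => Emb comm cca s (x a) ↔ Emb comm cca s (y a)) (by fun_prop)
    (primrecPred_iff (primrecPred_emb _ _ (by fun_prop) (by fun_prop))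
      (primrecPred_emb _ _ (by fun_prop) (by fun_prop)))).of_eq fun _ => by
    simp only [mem_forestsUpTo, and_imp, SameDown]

theorem primrecPred_sameType (comm : Bool) (hP : Primrec P) (hn : Primrec n) (hx : Primrec x)
    (hy : Primrec y) : PrimrecPred fun a =>
      SameType (P a).step (P a).init (P a).alphabet (n a) comm (x a) (y a) :=
  (primrecPred_eq (by fun_prop) (by fun_prop)).and
    ((primrecPred_iff (primrecPred_single (by fun_prop)) (primrecPred_single (by fun_prop))).and
      (primrecPred_sameDown _ _ (by fun_prop) (by fun_prop) (by fun_prop) (by fun_prop)))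

theorem primrecPred_similar (hk : Primrec k) (hm : Primrec m) (hx : Primrec x)
    (hy : Primrec y) : PrimrecPred fun a => Similar (k a) (m a) (x a) (y a) :=
  (primrecPred_sameDown _ _ (by fun_prop) (by fun_prop) (by fun_prop) (by fun_prop)).and
    (primrecPred_imp (primrecPred_single (by fun_prop))
      ((primrecPred_single (by fun_prop)).and ((primrecPred_eq (by fun_prop) (by fun_prop)).and
        (primrecPred_sameDown _ _ (by fun_prop) (by fun_prop) (by fun_prop) (by fun_prop)))))

theorem primrecPred_refines (comm : Bool) (hk : Primrec k) (hm : Primrec m) (hx : Primrec x)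
    (hy : Primrec y) : PrimrecPred fun a => Refines (k a) (m a) comm (x a) (y a) :=
  primrecPred_forall_mem (by fun_prop) (primrecPred_exists_mem (by fun_prop)
    ((primrecPred_similar (by fun_prop) (by fun_prop) (by fun_prop) (by fun_prop)).and
      (primrecPred_sameDown _ _ (by fun_prop) (by fun_prop) (by fun_prop) (by fun_prop))))

theorem primrecPred_posCert (comm cca : Bool) (hP : Primrec P) (hn : Primrec n)
    (hN : Primrec N) : PrimrecPred fun a =>
      PosCert (P a).step (P a).init (P a).alphabet comm cca (P a).Acc (n a) (N a) := by
  refine .and ?_ ?_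
  · refine primrecPred_forall_lt (by fun_prop) ?_
    refine primrecPred_forall_mem (by fun_prop) ?_
    refine primrecPred_forall_mem (by fun_prop) ?_
    refine primrecPred_exists_mem (by fun_prop) ?_
    refine .and (primrecPred_eq (by fun_prop) (by fun_prop)) (.and (primrecPred_iff
      (primrecPred_single (by fun_prop)) (primrecPred_single (by fun_prop))) ?_)
    exact primrecPred_forall_mem (by fun_prop) (primrecPred_iff
      (primrecPred_emb _ _ (by fun_prop) (by fun_prop))
      (primrecPred_emb _ _ (by fun_prop) (by fun_prop)))
  · refine primrecPred_forall_mem (by fun_prop) ?_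
    refine primrecPred_forall_mem (by fun_prop) ?_
    refine primrecPred_imp (primrecPred_single (by fun_prop)) ?_
    refine primrecPred_imp (primrecPred_single (by fun_prop)) ?_
    refine primrecPred_imp ?_ (primrecPred_iff (primrecPred_acc (by fun_prop) (by fun_prop))
      (primrecPred_acc (by fun_prop) (by fun_prop)))
    refine primrecPred_forall_mem (by fun_prop) (primrecPred_iff ?_ ?_)
    all_goals
      exact primrecPred_exists_mem (by fun_prop)
        ((primrecPred_emb _ _ (by fun_prop) (by fun_prop)).and
          (primrecPred_emb _ _ (by fun_prop) (by fun_prop)))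

theorem primrecPred_dirCert (comm comm' cca : Bool) (hP : Primrec P) (hn : Primrec n)
    (hm : Primrec m) (hN : Primrec N) (hM : Primrec M)
    (hI : PrimrecPred fun q : α × BForest => I q.1 q.2)
    (hJ : PrimrecPred fun q : α × BForest => J q.1 q.2)
    (hK : PrimrecPred fun q : α × BForest => K q.1 q.2) : PrimrecPred fun a =>
      DirCert (P a).step (P a).init (P a).alphabet (n a) comm comm' cca (I a) (J a) (K a)
        (m a) (N a) (M a) := by
  refine PrimrecPred.of_eq (.and ?_ (.and ?_ (.and ?_ ?_))) fun a =>
    ⟨fun h => DirCert.mk h.1 h.2.1 h.2.2.1 h.2.2.2,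
      fun h => ⟨h.pos, h.closed, h.transfer, h.bound⟩⟩
  · exact primrecPred_lt (by fun_prop) (by fun_prop)
  · refine primrecPred_forall_lt (by fun_prop) ?_
    refine primrecPred_forall_mem (by fun_prop) ?_
    refine primrecPred_forall_mem (by fun_prop) ?_
    refine primrecPred_exists_mem (by fun_prop) ?_
    exact .and (primrecPred_sameType _ (by fun_prop) (by fun_prop) (by fun_prop) (by fun_prop))
      (primrecPred_refines _ (by fun_prop) (by fun_prop) (by fun_prop) (by fun_prop))
  · refine primrecPred_forall_mem (by fun_prop) ?_
    refine primrecPred_forall_mem (by fun_prop) ?_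
    refine primrecPred_forall_mem (by fun_prop) ?_
    refine primrecPred_forall_mem (by fun_prop) ?_
    refine primrecPred_imp (primrecPred_sameDown _ _ (by fun_prop) (by fun_prop) (by fun_prop)
      (by fun_prop)) ?_
    refine primrecPred_imp (primrecPred_sameDown _ _ (by fun_prop) (by fun_prop) (by fun_prop)
      (by fun_prop)) ?_
    refine primrecPred_forall_mem (by fun_prop) ?_
    refine primrecPred_imp (primrecPred_emb _ _ (by fun_prop) (by fun_prop)) ?_
    refine primrecPred_imp (primrecPred_emb _ _ (by fun_prop) (by fun_prop)) ?_
    refine primrecPred_exists_mem (by fun_prop) ?_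
    exact .and (primrecPred_emb _ _ (by fun_prop) (by fun_prop))
      (.and (primrecPred_emb _ _ (by fun_prop) (by fun_prop))
        (primrecPred_sameType _ (by fun_prop) (by fun_prop) (by fun_prop) (by fun_prop)))
  · refine primrecPred_forall_mem (by fun_prop) ?_
    refine primrecPred_forall_mem (by fun_prop) ?_
    refine primrecPred_imp (hI.comp (by fun_prop :
      Primrec fun q : (α × BForest) × BForest => (q.1.1, q.1.2))) ?_
    refine primrecPred_imp (hJ.comp (by fun_prop :
      Primrec fun q : (α × BForest) × BForest => (q.1.1, q.2))) ?_
    refine primrecPred_exists_mem (by fun_prop) ?_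
    exact .and (hK.comp (by fun_prop :
      Primrec fun q : ((α × BForest) × BForest) × BForest => (q.1.1.1, q.2)))
      (.and (primrecPred_emb _ _ (by fun_prop) (by fun_prop))
        (primrecPred_emb _ _ (by fun_prop) (by fun_prop)))

theorem primrecPred_negCert (comm cca : Bool) {e₀ e₁ e₂ e₃ : α → ℕ × ℕ × ℕ} (hP : Primrec P)
    (hn : Primrec n) (hx : Primrec x) (hy : Primrec y) (h₀ : Primrec e₀) (h₁ : Primrec e₁)
    (h₂ : Primrec e₂) (h₃ : Primrec e₃) : PrimrecPred fun a =>
      NegCert (P a).step (P a).init (P a).alphabet comm cca (P a).Acc (n a) (x a) (y a) (e₀ a)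
        (e₁ a) (e₂ a) (e₃ a) := by
  refine PrimrecPred.of_eq (.and ?_ (.and ?_ (.and ?_ (.and ?_ (.and ?_ (.and ?_ ?_)))))) fun a =>
    ⟨fun h => NegCert.mk h.1 h.2.1 h.2.2.1 h.2.2.2.1 h.2.2.2.2.1 h.2.2.2.2.2.1 h.2.2.2.2.2.2,
      fun h => ⟨h.pos, h.left, h.right, h.dir_left, h.dir_right, h.cofinal_left, h.cofinal_right⟩⟩
  · exact primrecPred_lt (by fun_prop) (by fun_prop)
  · exact (primrecPred_val (by fun_prop) (by fun_prop)).and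
      ((primrecPred_single (by fun_prop)).and (primrecPred_acc (by fun_prop) (by fun_prop)))
  · exact (primrecPred_val (by fun_prop) (by fun_prop)).and
      ((primrecPred_single (by fun_prop)).and (primrecPred_acc (by fun_prop) (by fun_prop)).not)
  · exact primrecPred_dirCert _ _ _ (by fun_prop) (by fun_prop) (by fun_prop) (by fun_prop)
      (by fun_prop) (primrecPred_sub _ (by fun_prop) (by fun_prop) (by fun_prop) (by fun_prop))
      (primrecPred_sub _ (by fun_prop) (by fun_prop) (by fun_prop) (by fun_prop))
      (primrecPred_sameType _ (by fun_prop) (by fun_prop) (by fun_prop) (by fun_prop))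
  · exact primrecPred_dirCert _ _ _ (by fun_prop) (by fun_prop) (by fun_prop) (by fun_prop)
      (by fun_prop) (primrecPred_sub _ (by fun_prop) (by fun_prop) (by fun_prop) (by fun_prop))
      (primrecPred_sub _ (by fun_prop) (by fun_prop) (by fun_prop) (by fun_prop))
      (primrecPred_sameType _ (by fun_prop) (by fun_prop) (by fun_prop) (by fun_prop))
  · exact primrecPred_dirCert _ _ _ (by fun_prop) (by fun_prop) (by fun_prop) (by fun_prop)
      (by fun_prop) (primrecPred_sub _ (by fun_prop) (by fun_prop) (by fun_prop) (by fun_prop))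
      (primrecPred_eq (by fun_prop) (by fun_prop))
      (primrecPred_sub _ (by fun_prop) (by fun_prop) (by fun_prop) (by fun_prop))
  · exact primrecPred_dirCert _ _ _ (by fun_prop) (by fun_prop) (by fun_prop) (by fun_prop)
      (by fun_prop) (primrecPred_sub _ (by fun_prop) (by fun_prop) (by fun_prop) (by fun_prop))
      (primrecPred_eq (by fun_prop) (by fun_prop))
      (primrecPred_sub _ (by fun_prop) (by fun_prop) (by fun_prop) (by fun_prop))

end Primrec

/-- Post's theorem: the search for a `PosCert` and the search for a `NegCert` run in parallel, and
exactly one of them succeeds. -/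
theorem computablePred_testable (comm cca : Bool) : ComputablePred fun P : Presentation =>
    Testable P.alphabet comm cca fun t => P.Acc (run P.step P.init t) := by
  rw [ComputablePred.computable_iff_re_compl_re']
  constructor
  · refine (rePred_exists (p := fun (P : Presentation) (b : ℕ × ℕ) =>
      PosCert P.step P.init P.alphabet comm cca P.Acc b.1 b.2)
      (primrecPred_posCert _ _ (by fun_prop) (by fun_prop) (by fun_prop))).of_eq fun P => ?_
    obtain ⟨B, hB⟩ := P.exists_run_le
    rw [testable_iff_exists_posCert hB]
    exact ⟨fun ⟨b, h⟩ => ⟨b.1, b.2, h⟩, fun ⟨n, N, h⟩ => ⟨(n, N), h⟩⟩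
  · refine (rePred_exists (p := fun (P : Presentation) (b : (ℕ × BForest × BForest) ×
      ((ℕ × ℕ × ℕ) × (ℕ × ℕ × ℕ)) × (ℕ × ℕ × ℕ) × (ℕ × ℕ × ℕ)) =>
      NegCert P.step P.init P.alphabet comm cca P.Acc b.1.1 b.1.2.1 b.1.2.2
        b.2.1.1 b.2.1.2 b.2.2.1 b.2.2.2)
      (primrecPred_negCert _ _ (by fun_prop) (by fun_prop) (by fun_prop) (by fun_prop)
        (by fun_prop) (by fun_prop) (by fun_prop) (by fun_prop))).of_eq fun P => ?_
    obtain ⟨B, hB⟩ := P.exists_run_le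
    rw [not_testable_iff_exists_negCert hB]
    exact ⟨fun ⟨b, h⟩ => ⟨_, _, _, _, _, _, _, h⟩,
      fun ⟨n, t₀, t₁, e₀, e₁, e₂, e₃, h⟩ => ⟨((n, t₀, t₁), (e₀, e₁), e₂, e₃), h⟩⟩


-- Correctness for presentations of forest algebras.

open BForest

theorem getD_ofFn {σ : Type*} {n : ℕ} (g : Fin n → σ) (i : Fin n) (z : σ) :
    (List.ofFn g).getD i z = g i := by
  rw [List.getD_eq_getElem _ _ (by simp)]
  simp

section Presentation

variable {A H V : Type*} [AddMonoid H] [Monoid V] [MulAction V H] {k m n : ℕ} (eA : Fin k ≃ A)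
  (eH : Fin m ≃ H) (eV : Fin n ≃ V) (f : A → V) (X : Set H)

theorem alphabet_presentation : (presentation eA eH eV f X).alphabet = k := by
  simp [presentation, Presentation.alphabet]

theorem step_presentation (a : A) (x y : H) :
    (presentation eA eH eV f X).step (eA.symm a) (eH.symm x) (eH.symm y) =
      eH.symm (f a • x + y) := by
  simp only [presentation, Presentation.step, getD_ofFn, Equiv.apply_symm_apply]

theorem acc_presentation (x : H) :
    (presentation eA eH eV f X).Acc (eH.symm x) ↔ x ∈ X := by
  simp only [presentation, Presentation.Acc, getD_ofFn, Equiv.apply_symm_apply, decide_eq_true_eq]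

theorem run_presentation (t : Forest A) :
    run (presentation eA eH eV f X).step (presentation eA eH eV f X).init
      (toB (fun a => (eA.symm a : ℕ)) t) = eH.symm (evalForest f t) := by
  induction t using forest_induction with
  | nil => simp [run, evalForest, presentation, Presentation.init]
  | cons a c s ihc ihs =>
    rw [toB_cons, run, ihc, ihs, step_presentation, evalForest, evalTree]

end Presentation

theorem decidable_isTreeTestable (comm cca : Bool)
    (R : ∀ A : Type u, Forest A → Forest A → Prop)
    (hR : ∀ (A : Type u) (e : A → ℕ), Function.Injective e →
      ∀ s t, R A s t ↔ PieceRel comm cca (toB e s) (toB e t)) :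
    DecidableForRegularTreeLanguages.{u} fun A L => IsTreeTestable (R A) L := by
  obtain ⟨_, hc⟩ := computablePred_testable comm cca
  refine ⟨_, hc, fun A H V _ _ _ _ k m n eA eH eV f X hX => ?_⟩
  rw [decide_eq_true_eq]
  dsimp only
  rw [alphabet_presentation]
  exact (isTreeTestable_iff (e := fun a => (eA.symm a : ℕ))
    (fun i => ⟨fun hi => ⟨eA ⟨i, hi⟩, by simp⟩, fun ⟨a, ha⟩ => ha ▸ (eA.symm a).2⟩)
    (hR A _ (Fin.val_injective.comp eA.symm.injective)) hX fun t _ => by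
      rw [run_presentation, acc_presentation]; rfl).symm

end PiecewiseTestable

theorem mainTheorem10 :
    PiecewiseTestable.DecidableForRegularTreeLanguages.{u}
        (fun _ L => PiecewiseTestable.IsTreePT L) ∧
      PiecewiseTestable.DecidableForRegularTreeLanguages.{u}
        (fun _ L => PiecewiseTestable.IsTreeCcaPT L) ∧
      PiecewiseTestable.DecidableForRegularTreeLanguages.{u}
        (fun _ L => PiecewiseTestable.IsTreeCommPT L) ∧
      PiecewiseTestable.DecidableForRegularTreeLanguages.{u}
        (fun _ L => PiecewiseTestable.IsTreeCommCcaPT L) :=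
  ⟨PiecewiseTestable.decidable_isTreeTestable false false _
      fun _ _ he _ _ => PiecewiseTestable.piece_iff he,
    PiecewiseTestable.decidable_isTreeTestable false true _
      fun _ _ he _ _ => PiecewiseTestable.ccaPiece_iff he,
    PiecewiseTestable.decidable_isTreeTestable true false _
      fun _ _ he _ _ => PiecewiseTestable.commPiece_iff he,
    PiecewiseTestable.decidable_isTreeTestable true true _
      fun _ _ he _ _ => PiecewiseTestable.commCcaPiece_iff he⟩
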